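/- Consider a tree of $N$ rigid bodies in which the predecessor $p(i)$ of body $i$ is either the ground or a body with a smaller number. Write $j\preceq i$ if body $j$ lies on the path from body $i$ to the root, $i\sim j$ if $i\preceq j$ or $j\preceq i$, $\lceil ij\rceil$ for the one of two related bodies $i\sim j$ closest to the leaves, and $\lceil ijk\rceil=\lceil\lceil ij\rceil k\rceil$. Let $d$ be the depth of the tree (the largest number of bodies on a path to the root). Spatial motion vectors $v=(\omega,\mathrm v)\in\mathbb R^6$ and spatial force vectors $f=(n,\mathrm f)\in\mathbb R^6$ are written in Plücker coordinates in dual bases. With $S(a)$ the matrix of $x\mapsto a\times x$ put $$(v\times)=\begin{bmatrix}S(\omega)&0\\S(\mathrm v)&S(\omega)\end{bmatrix},\quad (v\times^*)=-(v\times)^\top,\quad (f\,\bar\times^*)=\begin{bmatrix}-S(n)&-S(\mathrm f)\\-S(\mathrm f)&0\end{bmatrix},$$ so that $(f\,\bar\times^*)v=(v\times^*)f$, and let $$B(v,I)=\tfrac12\big((v\times^*)I+((Iv)\,\bar\times^*)-I(v\times)\big)$$ be the Niemeyer–Slotine factorization. Every joint has a single degree of freedom: the pose of body $i$ relative to $p(i)$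 is a differentiable function of one coordinate $q_i\in\mathbb R$. Its joint axis $\Phi_i$ is the velocity of body $i$ relative to $p(i)$ at unit joint rate, and it is assumed that $\mathring\Phi_i=0$, i.e. the coordinates of $\Phi_i$ in the frame of body $i$ do not change with $q_i$. Let $I_i$ be the spatial inertia of body $i$, $I_j^C=\sum_{k\succeq j}I_k$ the composite inertia; $\Phi_i$, $I_i$, $I^C_j$ are functions of $q\in\mathbb R^N$ when expressed in ground coordinates. The body velocities are $v_i=v_{p(i)}+\Phi_i\dot q_i$ (with $v=0$ for the ground), $J_k(q)$ is the Jacobian with $v_k=J_k\dot q$, and the mass matrix is $M(q)=\sum_kJ_k^\top I_kJ_k$. Then $M$ is differentiable in $q$. Let $$\Gamma_{ijk}=\tfrac12\Big[\frac{\partial M_{ij}}{\partial q_k}+\frac{\partial M_{ik}}{\partial q_j}-\frac{\partial M_{jk}}{\partial q_i}\Big]$$ be the Christoffel symbols of the first kind. At every $q$ the following hold. 1. If $i\sim j$, $j\sim k$, $i\sim k$ and $j\preceq k$, then $\Gamma_{ijk}=\Gamma_{ikj}=\Phi_i^\top B(\Phi_k,I^C_{\lceil ijk\rceil})\Phi_j$.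 2. If $i,j,k$ are not mutually related, then $\Gamma_{ijk}=\Gamma_{ikj}=0$. 3. If $i\preceq j\preceq k$, then $$\Gamma_{ijk}=\Gamma_{ikj}=\Phi_i^\top B(\Phi_k,I_k^C)\Phi_j,\qquad \Gamma_{jik}=\Gamma_{jki}=\Phi_j^\top B(\Phi_k,I_k^C)\Phi_i,$$ $$\Gamma_{kij}=\Gamma_{kji}=\Phi_k^\top B(\Phi_j,I_k^C)\Phi_i=\tfrac12\Phi_i^\top\big[I_k^C(\Phi_k\times)-(\Phi_k\times^*)I_k^C+((I_k^C\Phi_k)\,\bar\times^*)\big]\Phi_j=\Phi_i^\top\big[((I_k^C\Phi_k)\,\bar\times^*)-B(\Phi_k,I_k^C)\big]\Phi_j.$$ 4. The following algorithm, carried out in body-fixed coordinates, returns all the symbols. Let ${}^iX_{p(i)}$ be the matrix that takes motion vectors from the coordinates of $p(i)$ to those of $i$. Initialize $I_i^C:=I_i$ for all $i$ (and $0$ for the ground), and all $\Gamma_{ijk}:=0$. For $k=N,\dots,1$: put $\tilde B:=B(\Phi_k,I_k^C)$ and $D:=((I_k^C\Phi_k)\,\bar\times^*)-\tilde B$; let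 $j$ run from $k$ through successive predecessors until the ground is reached, and for each $j$ put $F_1:=\tilde B\Phi_j$, $F_2:=\tilde B^\top\Phi_j$, $F_3:=D\Phi_j$; let $i$ run from $j$ through successive predecessors until the ground is reached, and for each $i$ assign $\Gamma_{ijk}=\Gamma_{ikj}:=\Phi_i^\top F_1$, $\Gamma_{jik}=\Gamma_{jki}:=\Phi_i^\top F_2$, $\Gamma_{kij}=\Gamma_{kji}:=\Phi_i^\top F_3$, and replace each $F_r$ by ${}^iX_{p(i)}^\top F_r$; after the loop over $i$, replace $\tilde B$ and $D$ by ${}^jX_{p(j)}^\top\tilde B\,{}^jX_{p(j)}$ and ${}^jX_{p(j)}^\top D\,{}^jX_{p(j)}$; after the loop over $j$, add ${}^kX_{p(k)}^\top I_k^C\,{}^kX_{p(k)}$ to $I_{p(k)}^C$. Given the predecessors, the body inertias, and the joint axes and joint transforms at $q$, it takes $O(Nd^2)$ elementary operations, with an absolute constant (the array of symbols being regarded as holding zeros beforehand). -/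

import Mathlib

open scoped Matrix

noncomputable section

namespace Spatial

/-! ### Spatial vector algebra in Plücker coordinates

A spatial motion vector `(ω, v)` and a spatial force vector `(n, f)` are elements of `ℝ³ ⊕ ℝ³`,
written in dual bases, so that the pairing of a motion and a force is the dot product, and the
adjoint of an operator is the transposed matrix. -/

/-- Vectors of `ℝ³`. -/
abbrev Vec3 := Fin 3 → ℝ

/-- Real `3 × 3` matrices. -/
abbrev Mat3 := Matrix (Fin 3) (Fin 3) ℝ

/-- Coordinates of spatial motion vectors and of spatial force vectors (angular part first). -/
abbrev SVec := Fin 3 ⊕ Fin 3 → ℝ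

/-- Coordinates of linear operators between spatial vectors. -/
abbrev SMat := Matrix (Fin 3 ⊕ Fin 3) (Fin 3 ⊕ Fin 3) ℝ

/-- The angular part. -/
def ang (v : SVec) : Vec3 := fun a => v (Sum.inl a)

/-- The linear part. -/
def lin (v : SVec) : Vec3 := fun a => v (Sum.inr a)

/-- The matrix `S(p)` of the Cartesian cross product `x ↦ p × x`. -/
def skew (p : Vec3) : Mat3 :=
  !![0, -p 2, p 1; p 2, 0, -p 0; -p 1, p 0, 0]

/-- The inverse of `skew` on skew-symmetric matrices. -/
def vee (W : Mat3) : Vec3 := ![W 2 1, W 0 2, W 1 0]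

/-- The motion/motion cross product `(v ×)`. -/
def crossM (v : SVec) : SMat :=
  Matrix.fromBlocks (skew (ang v)) 0 (skew (lin v)) (skew (ang v))

/-- The motion/force cross product `(v ×*)`, where `(v ×) = -(v ×*)ᵀ`. -/
def crossF (v : SVec) : SMat := -(crossM v)ᵀ

/-- The operator `(f ×̄*)` with swapped arguments, see `crossBar_mulVec`. -/
def crossBar (f : SVec) : SMat :=
  Matrix.fromBlocks (-skew (ang f)) (-skew (lin f)) (-skew (lin f)) 0

theorem crossBar_mulVec (f v : SVec) : crossBar f *ᵥ v = crossF v *ᵥ f := by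
  ext a
  rcases a with a | a <;> fin_cases a <;>
    simp [crossBar, crossF, crossM, skew, ang, lin, Matrix.mulVec, dotProduct, Fin.sum_univ_three]
      <;> ring

/-- The Niemeyer–Slotine body-level factorization
`B(v, I) = ½ ((v ×*) I + ((I v) ×̄*) - I (v ×))`. -/
def bodyB (v : SVec) (J : SMat) : SMat :=
  (1 / 2 : ℝ) • (crossF v * J + crossBar (J *ᵥ v) - J * crossM v)

/-- A spatial inertia in body coordinates: mass `m`, first mass moment `m c` (with `c` the centre of
mass) and the symmetric Cartesian inertia tensor about the origin of the body frame. -/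
structure Inertia where
  mass : ℝ
  moment : Vec3
  tensor : Mat3
  tensor_symm : tensor.IsSymm

/-- The `6 × 6` matrix of a spatial inertia. -/
def Inertia.toMat (J : Inertia) : SMat :=
  Matrix.fromBlocks J.tensor (skew J.moment) (skew J.moment)ᵀ (J.mass • (1 : Mat3))

/-! ### Poses and coordinate transforms -/

/-- The pose of a frame `B` relative to a frame `A`: `rot` takes `B`-coordinates of Cartesian vectors
to `A`-coordinates, `trans` is the position of the origin of `B` in `A`-coordinates. -/
structure Pose where
  rot : Mat3
  trans : Vec3
  rot_mem : rot ∈ Matrix.specialOrthogonalGroup (Fin 3) ℝ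

/-- The pose of a frame relative to itself. -/
def Pose.one : Pose := ⟨1, 0, one_mem _⟩

/-- The pose of `C` relative to `A`, from `B` relative to `A` and `C` relative to `B`. -/
def Pose.comp (P Q : Pose) : Pose :=
  ⟨P.rot * Q.rot, P.trans + P.rot *ᵥ Q.trans, mul_mem P.rot_mem Q.rot_mem⟩

/-- `ᴮX_A`: takes `A`-coordinates of motion vectors to `B`-coordinates. -/
def Pose.X (P : Pose) : SMat :=
  Matrix.fromBlocks P.rotᵀ 0 (-(P.rotᵀ * skew P.trans)) P.rotᵀ

/-- `ᴬX_B`, the inverse of `Pose.X`: takes `B`-coordinates of motion vectors to `A`-coordinates. -/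
def Pose.Xinv (P : Pose) : SMat :=
  Matrix.fromBlocks P.rot 0 (skew P.trans * P.rot) P.rot

/-- A single-DoF joint: the pose of the successor body relative to its predecessor, as a
differentiable function of the joint coordinate. -/
structure Joint where
  pose : ℝ → Pose
  rot_diff : ∀ a b, Differentiable ℝ fun x => (pose x).rot a b
  trans_diff : Differentiable ℝ fun x => (pose x).trans

/-- The joint axis `Φ` in the coordinates of the successor body: the angular velocity
`(Rᵀ R')^∨` and the linear velocity `Rᵀ p'` of the successor frame relative to the predecessor at
unit joint rate. -/
def Joint.axis (c : Joint) (x : ℝ) : SVec :=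
  Sum.elim
    (vee ((c.pose x).rotᵀ * Matrix.of fun a b => deriv (fun y => (c.pose y).rot a b) x))
    ((c.pose x).rotᵀ *ᵥ deriv (fun y => (c.pose y).trans) x)

/-! ### Rigid-body trees -/

/-- A tree of `N` rigid bodies with single-DoF joints. The predecessor of a body is either a body with
a smaller number or the ground (`none`). -/
structure RigidTree (N : ℕ) where
  parent : Fin N → Option (Fin N)
  parent_lt : ∀ i p, parent i = some p → p < i
  joint : Fin N → Joint
  inertia : Fin N → Inertia

namespace RigidTree

variable {N : ℕ} (T : RigidTree N)

/-- `T.anc j i` is `j ⪯ i`: body `j` lies on the path from body `i` to the root. -/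
def anc (j i : Fin N) : Prop :=
  Relation.ReflTransGen (fun a b => T.parent a = some b) i j

/-- `i ∼ j`. -/
def related (i j : Fin N) : Prop := T.anc i j ∨ T.anc j i

/-- `i`, `j` and `k` are mutually related. -/
def mutuallyRelated (i j k : Fin N) : Prop := T.related i j ∧ T.related j k ∧ T.related i k

open Classical in
/-- `⌈ij⌉`: of two related bodies, the one closest to the leaves. -/
def leafmost (i j : Fin N) : Fin N := if T.anc j i then i else j

open Classical in
/-- The depth of the tree: the largest number of bodies on a path from a body to the root. -/
def depth : ℕ :=
  Finset.univ.sup fun i : Fin N => (Finset.univ.filter fun j : Fin N => T.anc j i).card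

/-- Forward kinematics: the pose of body `i` relative to the ground. -/
def pose (q : Fin N → ℝ) (i : Fin N) : Pose :=
  match _h : T.parent i with
  | none => (T.joint i).pose (q i)
  | some p => (pose q p).comp ((T.joint i).pose (q i))
termination_by i
decreasing_by exact T.parent_lt i p _h

/-- The joint axis `Φ_i` in ground coordinates. -/
def Φ (q : Fin N → ℝ) (i : Fin N) : SVec :=
  (T.pose q i).Xinv *ᵥ (T.joint i).axis (q i)

/-- The spatial inertia of body `i` in ground coordinates. -/
def groundInertia (q : Fin N → ℝ) (i : Fin N) : SMat :=
  (T.pose q i).Xᵀ * (T.inertia i).toMat * (T.pose q i).X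

open Classical in
/-- The composite inertia `I_j^C`, the sum of the inertias of body `j` and its descendants, in ground
coordinates. -/
def compositeInertia (q : Fin N → ℝ) (j : Fin N) : SMat :=
  ∑ k ∈ Finset.univ.filter (fun k : Fin N => T.anc j k), T.groundInertia q k

/-- The spatial velocity of body `i` in ground coordinates, `v_i = v_{p(i)} + Φ_i q̇_i`. -/
def velocity (q qd : Fin N → ℝ) (i : Fin N) : SVec :=
  match _h : T.parent i with
  | none => qd i • T.Φ q i
  | some p => velocity q qd p + qd i • T.Φ q i
termination_by i
decreasing_by exact T.parent_lt i p _h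

/-- The body Jacobian `J_k`, with `v_k = J_k q̇`. -/
def jacobian (q : Fin N → ℝ) (k : Fin N) : Matrix (Fin 3 ⊕ Fin 3) (Fin N) ℝ :=
  Matrix.of fun a j => T.velocity q (Pi.single j 1) k a

/-- The mass matrix `M = ∑ J_kᵀ I_k J_k`, so that the kinetic energy is `½ q̇ᵀ M q̇`. -/
def massMatrix (q : Fin N → ℝ) : Matrix (Fin N) (Fin N) ℝ :=
  ∑ k, (T.jacobian q k)ᵀ * T.groundInertia q k * T.jacobian q k

/-- The partial derivative `∂M_ij / ∂q_k`. -/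
def dMass (q : Fin N → ℝ) (i j k : Fin N) : ℝ :=
  deriv (fun x => T.massMatrix (Function.update q k x) i j) (q k)

/-- The Christoffel symbols of the first kind
`Γ_ijk = ½ (∂M_ij/∂q_k + ∂M_ik/∂q_j - ∂M_jk/∂q_i)`. -/
def Γ (q : Fin N → ℝ) (i j k : Fin N) : ℝ :=
  (1 / 2 : ℝ) * (T.dMass q i j k + T.dMass q i k j - T.dMass q j k i)

end RigidTree

/-! ### The recursive algorithm, with a count of elementary operations -/

/-- A result together with the number of elementary operations spent on it. -/
structure Timed (α : Type) where
  val : α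
  cost : ℕ

instance : Monad Timed where
  pure a := ⟨a, 0⟩
  bind x f := ⟨(f x.val).val, x.cost + (f x.val).cost⟩

namespace Timed

/-! Every arithmetic operation on reals, every assignment of a real to a memory cell, and every
lookup of a predecessor is one elementary operation. Products are the schoolbook ones. -/

def mulVec (A : SMat) (v : SVec) : Timed SVec := ⟨A *ᵥ v, 66⟩
def mulMat (A B : SMat) : Timed SMat := ⟨A * B, 396⟩
def dot (v w : SVec) : Timed ℝ := ⟨v ⬝ᵥ w, 11⟩
def transpose (A : SMat) : Timed SMat := ⟨Aᵀ, 36⟩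
def add (A B : SMat) : Timed SMat := ⟨A + B, 36⟩
def sub (A B : SMat) : Timed SMat := ⟨A - B, 36⟩
def half (A : SMat) : Timed SMat := ⟨(1 / 2 : ℝ) • A, 36⟩
def crossM (v : SVec) : Timed SMat := ⟨Spatial.crossM v, 36⟩
def crossF (v : SVec) : Timed SMat := ⟨Spatial.crossF v, 36⟩
def crossBar (f : SVec) : Timed SMat := ⟨Spatial.crossBar f, 36⟩

/-- The congruence transform `Xᵀ A X`. -/
def congr (X A : SMat) : Timed SMat := do
  let Xt ← transpose X
  let B ← mulMat Xt A
  mulMat B X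

/-- Transform of a force vector by `Xᵀ`. -/
def forceBack (X : SMat) (f : SVec) : Timed SVec := do
  let Xt ← transpose X
  mulVec Xt f

variable {N : ℕ}

/-- Assignment of a value to the entry `(i, j, k)` of an array. -/
def assign (G : Fin N → Fin N → Fin N → ℝ) (i j k : Fin N) (x : ℝ) :
    Timed (Fin N → Fin N → Fin N → ℝ) :=
  ⟨fun a b c => if a = i ∧ b = j ∧ c = k then x else G a b c, 1⟩

/-- Assignment of a matrix to one slot of the array of composite inertias, which has one slot for each
body and one for the ground (`none`). -/
def assignMat (IC : Option (Fin N) → SMat) (i : Option (Fin N)) (A : SMat) :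
    Timed (Option (Fin N) → SMat) :=
  ⟨Function.update IC i A, 36⟩

end Timed

namespace RigidTree

variable {N : ℕ} (T : RigidTree N)

/-- The matrix `ⁱX_{p(i)}`. -/
def X (q : Fin N → ℝ) (i : Fin N) : SMat := ((T.joint i).pose (q i)).X

/-- Lookup of the predecessor, `none` being the ground. -/
def lookup (i : Fin N) : Timed (Option (Fin N)) := ⟨T.parent i, 1⟩

/-- The inner while loop, from `i` down to the root. -/
def loopI (q : Fin N → ℝ) (j k : Fin N) (i : Fin N) (F₁ F₂ F₃ : SVec)
    (G : Fin N → Fin N → Fin N → ℝ) : Timed (Fin N → Fin N → Fin N → ℝ) := do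
  let g₁ ← Timed.dot ((T.joint i).axis (q i)) F₁
  let G ← Timed.assign G i j k g₁
  let G ← Timed.assign G i k j g₁
  let g₂ ← Timed.dot ((T.joint i).axis (q i)) F₂
  let G ← Timed.assign G j i k g₂
  let G ← Timed.assign G j k i g₂
  let g₃ ← Timed.dot ((T.joint i).axis (q i)) F₃
  let G ← Timed.assign G k i j g₃
  let G ← Timed.assign G k j i g₃
  let F₁ ← Timed.forceBack (T.X q i) F₁
  let F₂ ← Timed.forceBack (T.X q i) F₂
  let F₃ ← Timed.forceBack (T.X q i) F₃
  let _ ← T.lookup i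
  match _h : T.parent i with
  | none => pure G
  | some p => loopI q j k p F₁ F₂ F₃ G
termination_by i
decreasing_by exact T.parent_lt i p _h

/-- The outer while loop, from `j` down to the root. -/
def loopJ (q : Fin N → ℝ) (k : Fin N) (j : Fin N) (B D : SMat)
    (G : Fin N → Fin N → Fin N → ℝ) : Timed (Fin N → Fin N → Fin N → ℝ) := do
  let F₁ ← Timed.mulVec B ((T.joint j).axis (q j))
  let Bt ← Timed.transpose B
  let F₂ ← Timed.mulVec Bt ((T.joint j).axis (q j))
  let F₃ ← Timed.mulVec D ((T.joint j).axis (q j))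
  let G ← T.loopI q j k j F₁ F₂ F₃ G
  let B ← Timed.congr (T.X q j) B
  let D ← Timed.congr (T.X q j) D
  let _ ← T.lookup j
  match _h : T.parent j with
  | none => pure G
  | some p => loopJ q k p B D G
termination_by j
decreasing_by exact T.parent_lt j p _h

/-- One pass of the main loop, for body `k`. The state is the array of composite inertias, each in the
coordinates of its own body, and the array of symbols. -/
def passK (q : Fin N → ℝ)
    (s : (Option (Fin N) → SMat) × (Fin N → Fin N → Fin N → ℝ)) (k : Fin N) :
    Timed ((Option (Fin N) → SMat) × (Fin N → Fin N → Fin N → ℝ)) := do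
  let cF ← Timed.crossF ((T.joint k).axis (q k))
  let t₁ ← Timed.mulMat cF (s.1 (some k))
  let f ← Timed.mulVec (s.1 (some k)) ((T.joint k).axis (q k))
  let fbar ← Timed.crossBar f
  let cM ← Timed.crossM ((T.joint k).axis (q k))
  let t₂ ← Timed.mulMat (s.1 (some k)) cM
  let t₃ ← Timed.add t₁ fbar
  let t₄ ← Timed.sub t₃ t₂
  let B ← Timed.half t₄
  let D ← Timed.sub fbar B
  let G ← T.loopJ q k k B D s.2
  let t₅ ← Timed.congr (T.X q k) (s.1 (some k))
  let p ← T.lookup k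
  let t₆ ← Timed.add (s.1 p) t₅
  let IC ← Timed.assignMat s.1 p t₆
  pure (IC, G)

/-- The Christoffel symbols algorithm in body-fixed coordinates. Given are the predecessors, the body
inertias, and the joint transforms and joint axes at `q`. Entries of the array of symbols that are
never assigned read as `0`. -/
def christoffelAlgorithm (q : Fin N → ℝ) : Timed (Fin N → Fin N → Fin N → ℝ) := do
  let IC ← (List.finRange N).foldlM
    (fun IC i => Timed.assignMat IC (some i) (T.inertia i).toMat) (fun _ => 0)
  let s ← (List.finRange N).reverse.foldlM (T.passK q) (IC, fun _ _ _ => 0)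
  pure s.2

end RigidTree

end Spatial

end

noncomputable section

namespace Spatial

/-! ### Identities of spatial vector algebra -/

/-! The mass matrix entry `M_ij` is the sum of `Φ_iᵀ I_m Φ_j` over the bodies `m` below both `i` and
`j`. Turning joint `l` moves the subtree of `l` rigidly with spatial velocity `Φ_l` and fixes all
else. So `Φ_i` changes by `Φ_l × Φ_i` if `l ⪯ i` (this is where constancy of the axis in body
coordinates enters), and `I_m` by `(Φ_l ×*) I_m - I_m (Φ_l ×)` if `l ⪯ m`. A factor of the pairing
that moves along with `I_m` cancels one of these two terms, so a term survives only for an index at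
or above `l` (`dMass_eq_sum`). Summing over `m` turns the `I_m` into the composite inertia of the
leafmost index, and the sum is empty unless the indices are mutually related.

Along a chain `i ⪯ j ⪯ k` this leaves two terms in `∂M_ij/∂q_k`, one in `∂M_ik/∂q_j` and none in
`∂M_jk/∂q_i`. Half their signed sums are the Christoffel symbols; with `Φ_i` on the left the
operator is exactly `B(Φ_k, I_k^C)`. The other orders of the indices follow by transposition and
from the exchange identity `dotProduct_bodyB_mulVec_eq`, which uses symmetry of the inertia.

For the algorithm, each matrix in the loops is `Xinvᵀ A Xinv` for an `A` fixed in ground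
coordinates, and a step to the predecessor only changes the frame (`congr_parent`, `bodyB_congr`).
Children have larger numbers, so a composite inertia is complete when its body is reached. Mutually
related triples are chains, hence all visited; the other symbols are zero. For each body both nested
loops follow paths of at most `d` bodies, which gives the cost. -/

theorem skew_add (p r : Vec3) : skew (p + r) = skew p + skew r := by
  ext a b; fin_cases a <;> fin_cases b <;> simp [skew] <;> ring

theorem transpose_skew (p : Vec3) : (skew p)ᵀ = -skew p := by
  ext a b; fin_cases a <;> fin_cases b <;> simp [skew]

theorem skew_vee {W : Mat3} (hW : Wᵀ = -W) : skew (vee W) = W := by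
  have h : ∀ a b, W b a = -W a b := fun a b => congrFun (congrFun hW a) b
  have h0 := h 0 0
  have h1 := h 1 1
  have h2 := h 2 2
  have h01 := h 0 1
  have h02 := h 0 2
  have h12 := h 1 2
  ext a b
  fin_cases a <;> fin_cases b <;> simp [skew, vee] <;> linarith

theorem skew_skew_mulVec (p r : Vec3) :
    skew (skew p *ᵥ r) = skew p * skew r - skew r * skew p := by
  ext a b
  fin_cases a <;> fin_cases b <;>
    simp [skew, Matrix.mulVec, dotProduct, Fin.sum_univ_three] <;> ring

/-- This is the scaling of the triple product by `det A`. For a rotation it says that `S` commutes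
with change of frame; an improper orthogonal matrix would bring in a sign. -/
theorem transpose_mul_skew_mul (A : Mat3) (p : Vec3) :
    Aᵀ * skew (A *ᵥ p) * A = A.det • skew p := by
  ext a b
  fin_cases a <;> fin_cases b <;>
    simp [skew, Matrix.mulVec, Matrix.mul_apply, dotProduct, Fin.sum_univ_three,
      Matrix.det_fin_three] <;> ring

/-! ### Poses -/

namespace Pose

variable (P Q : Pose)

theorem rot_transpose_mul : P.rotᵀ * P.rot = 1 := by
  have h := (Matrix.mem_specialOrthogonalGroup_iff.1 P.rot_mem).1
  simpa [Matrix.star_eq_conjTranspose] using (Matrix.mem_orthogonalGroup_iff' (Fin 3) ℝ).1 h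

theorem rot_mul_transpose : P.rot * P.rotᵀ = 1 :=
  mul_eq_one_comm.1 P.rot_transpose_mul

theorem det_rot : P.rot.det = 1 := (Matrix.mem_specialOrthogonalGroup_iff.1 P.rot_mem).2

theorem skew_rot_mulVec_mul (p : Vec3) : skew (P.rot *ᵥ p) * P.rot = P.rot * skew p := by
  have h := congrArg (P.rot * ·) (transpose_mul_skew_mul P.rot p)
  simpa [← mul_assoc, P.rot_mul_transpose, P.det_rot] using h

theorem Xinv_comp : (P.comp Q).Xinv = P.Xinv * Q.Xinv := by
  simp only [Xinv, comp, Matrix.fromBlocks_multiply, skew_add, add_mul, Matrix.zero_mul,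
    Matrix.mul_zero, add_zero, zero_add]
  rw [← mul_assoc (skew (P.rot *ᵥ Q.trans)) P.rot, skew_rot_mulVec_mul]
  simp only [mul_assoc]

theorem X_mul_Xinv : P.X * P.Xinv = 1 := by
  simp only [X, Xinv, Matrix.fromBlocks_multiply, rot_transpose_mul, Matrix.zero_mul,
    Matrix.mul_zero, add_zero, neg_mul, mul_assoc, neg_add_cancel, rot_transpose_mul]
  rw [← Matrix.fromBlocks_one]
  congr 1
  simp

theorem Xinv_mul_X : P.Xinv * P.X = 1 := mul_eq_one_comm.1 P.X_mul_Xinv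

/-- Rigid motions preserve the pairing of angular with linear parts, so inverting a transform is
transposing it with the two parts swapped. Smoothness and derivatives of `X` can then be read off
from `Xinv` without differentiating an inverse. -/
theorem X_apply (a b : Fin 3 ⊕ Fin 3) : P.X a b = P.Xinv b.swap a.swap := by
  rcases a with a | a <;> rcases b with b | b <;> simp [X, Xinv]
  have h := congrFun (congrFun (Matrix.transpose_mul (skew P.trans) P.rot) a) b
  rw [transpose_skew, mul_neg] at h
  simpa using h.symm

theorem X_eq_submatrix : P.X = P.Xinvᵀ.submatrix Sum.swap Sum.swap := by
  ext a b; exact P.X_apply a b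

/-- Change of frame is an automorphism of the motion bracket. The equivariance of `crossF`,
`crossBar` and `bodyB` all comes from this. -/
theorem crossM_Xinv_mulVec_mul (v : SVec) :
    crossM (P.Xinv *ᵥ v) * P.Xinv = P.Xinv * crossM v := by
  have ha : ang (P.Xinv *ᵥ v) = P.rot *ᵥ ang v := by
    ext a; simp [ang, Xinv, Matrix.mulVec, dotProduct]
  have hl : lin (P.Xinv *ᵥ v) = skew P.trans *ᵥ (P.rot *ᵥ ang v) + P.rot *ᵥ lin v := by
    ext a
    rw [Matrix.mulVec_mulVec]
    simp [ang, lin, Xinv, Matrix.mulVec, dotProduct]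
  rw [crossM, crossM, ha, hl, skew_add, skew_skew_mulVec]
  simp only [Xinv, Matrix.fromBlocks_multiply, Matrix.zero_mul, Matrix.mul_zero, add_zero,
    zero_add, add_mul, sub_mul, sub_zero, skew_rot_mulVec_mul]
  congr 1
  rw [mul_assoc (skew P.trans), skew_rot_mulVec_mul]
  simp only [mul_assoc]
  abel

theorem transpose_Xinv_mul_crossF (v : SVec) :
    P.Xinvᵀ * crossF (P.Xinv *ᵥ v) = crossF v * P.Xinvᵀ := by
  have h := congrArg Matrix.transpose (P.crossM_Xinv_mulVec_mul v)
  simp only [Matrix.transpose_mul] at h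
  simp only [crossF, mul_neg, neg_mul, h]

theorem transpose_Xinv_mul_crossBar (f : SVec) :
    P.Xinvᵀ * crossBar f * P.Xinv = crossBar (P.Xinvᵀ *ᵥ f) := by
  refine Matrix.ext_iff_mulVec.2 fun w => ?_
  rw [crossBar_mulVec, Matrix.mulVec_mulVec, ← transpose_Xinv_mul_crossF, mul_assoc,
    ← Matrix.mulVec_mulVec, ← Matrix.mulVec_mulVec, ← Matrix.mulVec_mulVec, crossBar_mulVec]

/-- The factorization is frame-independent, which is what permits computing it in body coordinates.
-/
theorem bodyB_congr (v : SVec) (J : SMat) :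
    bodyB v (P.Xinvᵀ * J * P.Xinv) = P.Xinvᵀ * bodyB (P.Xinv *ᵥ v) J * P.Xinv := by
  simp only [bodyB, Matrix.mul_smul, Matrix.smul_mul, mul_add, mul_sub, add_mul, sub_mul]
  rw [transpose_Xinv_mul_crossBar, Matrix.mulVec_mulVec, Matrix.mulVec_mulVec]
  simp only [← mul_assoc]
  rw [← transpose_Xinv_mul_crossF]
  simp only [mul_assoc]
  rw [← crossM_Xinv_mulVec_mul]

end Pose

/-! ### Antisymmetry and duality of the cross-product operators -/

theorem crossM_mulVec_self (v : SVec) : crossM v *ᵥ v = 0 := by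
  ext a
  rcases a with a | a <;> fin_cases a <;>
    simp [crossM, skew, ang, lin, Matrix.mulVec, dotProduct, Fin.sum_univ_three] <;> ring

theorem crossM_mulVec_comm (v w : SVec) : crossM v *ᵥ w = -(crossM w *ᵥ v) := by
  ext a
  rcases a with a | a <;> fin_cases a <;>
    simp [crossM, skew, ang, lin, Matrix.mulVec, dotProduct, Fin.sum_univ_three] <;> ring

theorem dotProduct_crossF_mulVec (v w f : SVec) :
    w ⬝ᵥ (crossF v *ᵥ f) = -((crossM v *ᵥ w) ⬝ᵥ f) := by
  rw [crossF, Matrix.neg_mulVec, dotProduct_neg, Matrix.dotProduct_mulVec, Matrix.vecMul_transpose]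

theorem transpose_crossBar (f : SVec) : (crossBar f)ᵀ = -crossBar f := by
  simp [crossBar, Matrix.fromBlocks_transpose, Matrix.fromBlocks_neg, transpose_skew]

/-- The infinitesimal form of `Pose.X_apply`: it converts the derivative of `Xinv` into that of `X`.
-/
theorem crossM_swap_transpose (v : SVec) :
    (crossM v)ᵀ.submatrix Sum.swap Sum.swap = -crossM v := by
  ext a b
  rcases a with a | a <;> rcases b with b | b <;> fin_cases a <;> fin_cases b <;>
    simp [crossM, skew]

theorem Inertia.transpose_toMat (J : Inertia) : J.toMatᵀ = J.toMat := by
  simp [Inertia.toMat, Matrix.fromBlocks_transpose, J.tensor_symm.eq]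

/-! ### Entrywise derivatives of matrix-valued functions -/

/-- The matrix-valued function `A` of a real variable has the entrywise derivative `A'` at `x`. -/
def HasMatDerivAt {m n : Type*} (A : ℝ → Matrix m n ℝ) (A' : Matrix m n ℝ) (x : ℝ) : Prop :=
  ∀ a b, HasDerivAt (fun y => A y a b) (A' a b) x

namespace HasMatDerivAt

variable {l m n : Type*} {A : ℝ → Matrix l m ℝ} {A' : Matrix l m ℝ}
  {B : ℝ → Matrix m n ℝ} {B' : Matrix m n ℝ} {x : ℝ}

theorem mul [Fintype m] (hA : HasMatDerivAt A A' x) (hB : HasMatDerivAt B B' x) :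
    HasMatDerivAt (fun y => A y * B y) (A' * B x + A x * B') x := fun a b => by
  simp only [Matrix.mul_apply, Matrix.add_apply, ← Finset.sum_add_distrib]
  exact HasDerivAt.fun_sum fun c _ => (hA a c).mul (hB c b)

theorem transpose (hA : HasMatDerivAt A A' x) : HasMatDerivAt (fun y => (A y)ᵀ) A'ᵀ x :=
  fun a b => hA b a

theorem const (A : Matrix l m ℝ) (x : ℝ) : HasMatDerivAt (fun _ => A) 0 x :=
  fun a b => hasDerivAt_const x (A a b)

theorem mulVec [Fintype m] (hA : HasMatDerivAt A A' x) {v : ℝ → m → ℝ} {v' : m → ℝ}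
    (hv : ∀ a, HasDerivAt (fun y => v y a) (v' a) x) (a : l) :
    HasDerivAt (fun y => (A y *ᵥ v y) a) ((A' *ᵥ v x + A x *ᵥ v') a) x := by
  simp only [Matrix.mulVec, dotProduct, Pi.add_apply, ← Finset.sum_add_distrib]
  exact HasDerivAt.fun_sum fun c _ => (hA a c).mul (hv c)

end HasMatDerivAt

theorem hasDerivAt_dotProduct {m : Type*} [Fintype m] {u v : ℝ → m → ℝ} {u' v' : m → ℝ} {x : ℝ}
    (hu : ∀ a, HasDerivAt (fun y => u y a) (u' a) x)
    (hv : ∀ a, HasDerivAt (fun y => v y a) (v' a) x) :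
    HasDerivAt (fun y => u y ⬝ᵥ v y) (u' ⬝ᵥ v x + u x ⬝ᵥ v') x := by
  simp only [dotProduct, ← Finset.sum_add_distrib]
  exact HasDerivAt.fun_sum fun c _ => (hu c).mul (hv c)

/-! ### Joint kinematics -/

theorem Joint.hasMatDerivAt_Xinv (c : Joint) (x : ℝ) :
    HasMatDerivAt (fun y => (c.pose y).Xinv) ((c.pose x).Xinv * crossM (c.axis x)) x := by
  set R' : Mat3 := Matrix.of fun a b => deriv (fun y => (c.pose y).rot a b) x with hR'
  set p' : Vec3 := deriv (fun y => (c.pose y).trans) x with hp'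
  set P := c.pose x with hP
  have hR : HasMatDerivAt (fun y => (c.pose y).rot) R' x := fun a b =>
    (c.rot_diff a b x).hasDerivAt
  have hp : ∀ a, HasDerivAt (fun y => (c.pose y).trans a) (p' a) x :=
    hasDerivAt_pi.1 (c.trans_diff x).hasDerivAt
  have hS : HasMatDerivAt (fun y => skew (c.pose y).trans) (skew p') x := by
    intro a b
    fin_cases a <;> fin_cases b <;> simp [skew] <;>
      first | exact hasDerivAt_const _ _ | exact hp _ | exact (hp _).fun_neg
  -- Differentiating `Rᵀ R = 1` shows that `Rᵀ R'` is skew, so `vee` loses nothing.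
  have hskew : (P.rotᵀ * R')ᵀ = -(P.rotᵀ * R') := by
    have h := hR.transpose.mul hR
    simp only [Pose.rot_transpose_mul] at h
    rw [Matrix.transpose_mul, Matrix.transpose_transpose, eq_neg_iff_add_eq_zero]
    ext a b
    exact (h a b).unique (HasMatDerivAt.const 1 x a b)
  have hω : skew (ang (c.axis x)) = P.rotᵀ * R' := skew_vee hskew
  have hv : lin (c.axis x) = P.rotᵀ *ᵥ p' := rfl
  have hRω : P.rot * skew (ang (c.axis x)) = R' := by
    rw [hω, ← mul_assoc, P.rot_mul_transpose, one_mul]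
  have hRv : P.rot * skew (lin (c.axis x)) = skew p' * P.rot := by
    rw [← P.skew_rot_mulVec_mul, hv, Matrix.mulVec_mulVec, P.rot_mul_transpose, Matrix.one_mulVec]
  have key : P.Xinv * crossM (c.axis x) =
      Matrix.fromBlocks R' 0 (skew p' * P.rot + skew P.trans * R') R' := by
    simp only [Pose.Xinv, crossM, Matrix.fromBlocks_multiply, Matrix.mul_zero, Matrix.zero_mul,
      add_zero, zero_add, mul_assoc, hRω, hRv]
    rw [add_comm]
  rw [key]
  have hSR := hS.mul hR
  rintro (a | a) (b | b)
  · exact hR a b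
  · exact hasDerivAt_const _ _
  · exact hSR a b
  · exact hR a b

namespace RigidTree

variable {N : ℕ} (T : RigidTree N)

/-! ### The ancestor relation -/

theorem anc_refl (i : Fin N) : T.anc i i := Relation.ReflTransGen.refl

variable {T} in
theorem anc_trans {i j k : Fin N} (hij : T.anc i j) (hjk : T.anc j k) : T.anc i k :=
  Relation.ReflTransGen.trans hjk hij

variable {T} in
theorem le_of_anc {i j : Fin N} (h : T.anc i j) : i ≤ j := by
  unfold anc at h
  induction h with
  | refl => exact le_rfl
  | tail _ h ih => exact (T.parent_lt _ _ h).le.trans ih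

variable {T} in
theorem anc_antisymm {i j : Fin N} (h : T.anc i j) (h' : T.anc j i) : i = j :=
  le_antisymm (le_of_anc h) (le_of_anc h')

variable {T} in
theorem anc_total {i j m : Fin N} (hi : T.anc i m) (hj : T.anc j m) : T.anc i j ∨ T.anc j i :=
  (Relation.ReflTransGen.total_of_right_unique
    (fun _ _ _ h h' => Option.some.inj (h.symm.trans h')) hi hj).symm

variable {T} in
theorem anc_iff_of_none {i : Fin N} (h : T.parent i = none) (j : Fin N) : T.anc j i ↔ j = i := by
  rw [anc, Relation.ReflTransGen.cases_head_iff]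
  simp [h, eq_comm]

variable {T} in
theorem anc_iff_of_some {i p : Fin N} (h : T.parent i = some p) (j : Fin N) :
    T.anc j i ↔ j = i ∨ T.anc j p := by
  rw [anc, Relation.ReflTransGen.cases_head_iff]
  simp [h, eq_comm, anc]

variable {T} in
theorem not_anc_parent {i p : Fin N} (h : T.parent i = some p) : ¬ T.anc i p := fun h' =>
  (le_of_anc h').not_gt (T.parent_lt i p h)

/-- Induction from the root to the leaves. -/
theorem parent_induction {motive : Fin N → Prop}
    (none : ∀ i, T.parent i = none → motive i)
    (some : ∀ i p, T.parent i = some p → motive p → motive i) (i : Fin N) : motive i := by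
  induction i using WellFoundedLT.induction with
  | ind i ih =>
    rcases h : T.parent i with _ | p
    · exact none i h
    · exact some i p h (ih p (T.parent_lt i p h))

/-! ### Forward kinematics and its derivatives -/

variable {T} in
theorem pose_of_none {i : Fin N} (h : T.parent i = none) (q : Fin N → ℝ) :
    T.pose q i = (T.joint i).pose (q i) := by
  rw [pose]; split <;> simp_all

variable {T} in
theorem pose_of_some {i p : Fin N} (h : T.parent i = some p) (q : Fin N → ℝ) :
    T.pose q i = (T.pose q p).comp ((T.joint i).pose (q i)) := by
  rw [pose]; split <;> simp_all

open Classical in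
theorem velocity_single (q : Fin N → ℝ) (j i : Fin N) :
    T.velocity q (Pi.single j 1) i = if T.anc j i then T.Φ q j else 0 := by
  induction i using T.parent_induction with
  | none i h =>
    have hv : T.velocity q (Pi.single j 1) i = (Pi.single j 1 : Fin N → ℝ) i • T.Φ q i := by
      rw [velocity]; split <;> simp_all
    rw [hv]
    by_cases hij : j = i
    · subst hij; simp [T.anc_refl]
    · simp [anc_iff_of_none h, hij, Ne.symm hij]
  | some i p h ih =>
    have hv : T.velocity q (Pi.single j 1) i =
        T.velocity q (Pi.single j 1) p + (Pi.single j 1 : Fin N → ℝ) i • T.Φ q i := by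
      rw [velocity]; split <;> simp_all
    rw [hv, ih]
    by_cases hij : j = i
    · subst hij; simp [T.anc_refl, not_anc_parent h]
    · simp [anc_iff_of_some h, hij, Ne.symm hij]

open Classical in
theorem massMatrix_apply (q : Fin N → ℝ) (i j : Fin N) :
    T.massMatrix q i j = ∑ m, if T.anc i m ∧ T.anc j m then
      T.Φ q i ⬝ᵥ (T.groundInertia q m *ᵥ T.Φ q j) else 0 := by
  rw [massMatrix, Matrix.sum_apply]
  refine Finset.sum_congr rfl fun m _ => ?_
  have h : ((T.jacobian q m)ᵀ * T.groundInertia q m * T.jacobian q m) i j =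
      T.velocity q (Pi.single i 1) m ⬝ᵥ
        (T.groundInertia q m *ᵥ T.velocity q (Pi.single j 1) m) := by
    rw [Matrix.mul_assoc, Matrix.mul_apply]
    rfl
  rw [h, velocity_single, velocity_single]
  by_cases hi : T.anc i m <;> by_cases hj : T.anc j m <;> simp [hi, hj]

-- The joint rule gives the velocity in body coordinates, on the right of `Xinv`; `hself` moves it
-- to the left as `Φ_k` in ground coordinates. For `i = k` only the last factor of the pose varies,
-- for `i ≠ k` only the pose of the predecessor can.
open Classical in
theorem hasMatDerivAt_Xinv (q : Fin N → ℝ) (k i : Fin N) :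
    HasMatDerivAt (fun x => (T.pose (Function.update q k x) i).Xinv)
      (if T.anc k i then crossM (T.Φ q k) * (T.pose q i).Xinv else 0) (q k) := by
  have hself : (T.pose q k).Xinv * crossM ((T.joint k).axis (q k)) =
      crossM (T.Φ q k) * (T.pose q k).Xinv := (Pose.crossM_Xinv_mulVec_mul _ _).symm
  induction i using T.parent_induction with
  | none i h =>
    simp only [pose_of_none h]
    by_cases hik : k = i
    · subst hik
      rw [pose_of_none h] at hself
      rw [if_pos (T.anc_refl k), ← hself]
      simpa using (T.joint k).hasMatDerivAt_Xinv (q k)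
    · simpa [anc_iff_of_none h, hik, Function.update_of_ne (Ne.symm hik)] using
        HasMatDerivAt.const _ (q k)
  | some i p h ih =>
    simp only [pose_of_some h, Pose.Xinv_comp]
    by_cases hik : k = i
    · subst hik
      rw [pose_of_some h, Pose.Xinv_comp, mul_assoc] at hself
      rw [if_neg (not_anc_parent h)] at ih
      rw [if_pos (T.anc_refl k), ← hself]
      simpa using ih.mul (B := fun x => ((T.joint k).pose (Function.update q k x k)).Xinv)
        (by simpa using (T.joint k).hasMatDerivAt_Xinv (q k))
    · have h2 := ih.mul (HasMatDerivAt.const (((T.joint i).pose (q i)).Xinv) (q k))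
      simp only [Function.update_of_ne (Ne.symm hik)]
      convert h2 using 1
      by_cases hp : T.anc k p <;> simp [anc_iff_of_some h, hik, hp, mul_assoc]

open Classical in
theorem hasMatDerivAt_X (q : Fin N → ℝ) (k i : Fin N) :
    HasMatDerivAt (fun x => (T.pose (Function.update q k x) i).X)
      (if T.anc k i then -((T.pose q i).X * crossM (T.Φ q k)) else 0) (q k) := by
  have h := T.hasMatDerivAt_Xinv q k i
  have key : (if T.anc k i then -((T.pose q i).X * crossM (T.Φ q k)) else 0) =
      ((if T.anc k i then crossM (T.Φ q k) * (T.pose q i).Xinv else 0)ᵀ).submatrix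
        Sum.swap Sum.swap := by
    split_ifs
    · rw [Matrix.transpose_mul, ← mul_neg, ← crossM_swap_transpose, Pose.X_eq_submatrix]
      exact Matrix.submatrix_mul_equiv _ _ _ (Equiv.sumComm (Fin 3) (Fin 3)) _
    · rfl
  rw [key]
  intro a b
  simp only [Pose.X_apply]
  exact h _ _

open Classical in
theorem hasMatDerivAt_groundInertia (q : Fin N → ℝ) (k i : Fin N) :
    HasMatDerivAt (fun x => T.groundInertia (Function.update q k x) i)
      (if T.anc k i then crossF (T.Φ q k) * T.groundInertia q i -
        T.groundInertia q i * crossM (T.Φ q k) else 0) (q k) := by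
  have h := T.hasMatDerivAt_X q k i
  have h2 := (h.transpose.mul (HasMatDerivAt.const (T.inertia i).toMat (q k))).mul h
  unfold groundInertia
  convert h2 using 1
  simp only [Function.update_eq_self]
  split_ifs
  · simp only [crossF, Matrix.transpose_neg, Matrix.transpose_mul, Matrix.mul_zero, add_zero,
      neg_mul, mul_neg, mul_assoc, sub_eq_add_neg]
  · simp

open Classical in
theorem hasDerivAt_Φ (hT : ∀ (i : Fin N) (x : ℝ), HasDerivAt (T.joint i).axis 0 x)
    (q : Fin N → ℝ) (k i : Fin N) (a : Fin 3 ⊕ Fin 3) :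
    HasDerivAt (fun x => T.Φ (Function.update q k x) i a)
      ((if T.anc k i then crossM (T.Φ q k) *ᵥ T.Φ q i else 0 : SVec) a) (q k) := by
  -- By `hT` the body coordinates of the axis are stationary, so only the transport by `Xinv`
  -- contributes.
  have hax : ∀ b, HasDerivAt (fun x => (T.joint i).axis (Function.update q k x i) b)
      ((0 : SVec) b) (q k) := by
    by_cases hik : i = k
    · subst hik
      simpa using hasDerivAt_pi.1 (hT i (q i))
    · intro b
      simpa [Function.update_of_ne hik] using hasDerivAt_const (q k) ((T.joint i).axis (q i) b)
  refine ((T.hasMatDerivAt_Xinv q k i).mulVec hax a).congr_deriv ?_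
  simp only [Function.update_eq_self]
  split_ifs <;> simp [Φ]

/-- Joint differentiability in `q` needs its own induction along the tree: the partial derivatives
computed above do not imply it. -/
theorem differentiable_Xinv (i : Fin N) (a b : Fin 3 ⊕ Fin 3) :
    Differentiable ℝ fun q : Fin N → ℝ => (T.pose q i).Xinv a b := by
  have hj : ∀ i a b, Differentiable ℝ fun q : Fin N → ℝ => ((T.joint i).pose (q i)).Xinv a b :=
    fun i a b q => DifferentiableAt.comp (f := fun q : Fin N → ℝ => q i)
      (g := fun x => ((T.joint i).pose x).Xinv a b) q
      ((T.joint i).hasMatDerivAt_Xinv (q i) a b).differentiableAt (by fun_prop)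
  induction i using T.parent_induction generalizing a b with
  | none i h => simpa only [pose_of_none h] using hj i a b
  | some i p h ih =>
    simp only [pose_of_some h, Pose.Xinv_comp, Matrix.mul_apply]
    exact Differentiable.fun_sum fun c _ => (ih a c).mul (hj i c b)

theorem differentiable_Φ (hT : ∀ (i : Fin N) (x : ℝ), HasDerivAt (T.joint i).axis 0 x)
    (i : Fin N) (a : Fin 3 ⊕ Fin 3) : Differentiable ℝ fun q : Fin N → ℝ => T.Φ q i a := by
  simp only [Φ, Matrix.mulVec, dotProduct]
  refine Differentiable.fun_sum fun c _ => (T.differentiable_Xinv i a c).mul fun q => ?_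
  exact DifferentiableAt.comp (f := fun q : Fin N → ℝ => q i) q
    (hasDerivAt_pi.1 (hT i (q i)) c).differentiableAt (by fun_prop)

theorem differentiable_groundInertia (i : Fin N) (a b : Fin 3 ⊕ Fin 3) :
    Differentiable ℝ fun q : Fin N → ℝ => T.groundInertia q i a b := by
  simp only [groundInertia, Matrix.mul_apply, Matrix.transpose_apply, Pose.X_apply]
  exact Differentiable.fun_sum fun c _ => (Differentiable.fun_sum fun d _ =>
    (T.differentiable_Xinv i _ _).mul_const _).mul (T.differentiable_Xinv i _ _)

theorem differentiable_massMatrix (hT : ∀ (i : Fin N) (x : ℝ), HasDerivAt (T.joint i).axis 0 x)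
    (i j : Fin N) : Differentiable ℝ fun q : Fin N → ℝ => T.massMatrix q i j := by
  classical
  simp only [massMatrix_apply]
  refine Differentiable.fun_sum fun m _ => ?_
  split_ifs
  · simp only [Matrix.mulVec, dotProduct]
    exact Differentiable.fun_sum fun c _ => (T.differentiable_Φ hT i c).mul
      (Differentiable.fun_sum fun d _ =>
        (T.differentiable_groundInertia m c d).mul (T.differentiable_Φ hT j d))
  · exact differentiable_const _

/-! ### Derivatives of the mass matrix -/

open Classical in
theorem dMass_eq_sum (hT : ∀ (i : Fin N) (x : ℝ), HasDerivAt (T.joint i).axis 0 x)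
    (q : Fin N → ℝ) (i j l : Fin N) :
    T.dMass q i j l = ∑ m, if T.anc i m ∧ T.anc j m ∧ T.anc l m then
      (if T.anc i l then
        T.Φ q i ⬝ᵥ ((crossF (T.Φ q l) * T.groundInertia q m) *ᵥ T.Φ q j) else 0) -
      (if T.anc j l then
        T.Φ q i ⬝ᵥ ((T.groundInertia q m * crossM (T.Φ q l)) *ᵥ T.Φ q j) else 0) else 0 := by
  simp only [dMass, massMatrix_apply]
  refine HasDerivAt.deriv (HasDerivAt.fun_sum fun m _ => ?_)
  by_cases hij : T.anc i m ∧ T.anc j m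
  swap
  · have : ¬ (T.anc i m ∧ T.anc j m ∧ T.anc l m) := fun h => hij ⟨h.1, h.2.1⟩
    simp only [if_neg hij, if_neg this]
    exact hasDerivAt_const _ _
  obtain ⟨hi, hj⟩ := hij
  simp only [hi, hj, and_self, true_and, if_true]
  have hd := hasDerivAt_dotProduct (T.hasDerivAt_Φ hT q l i)
    ((T.hasMatDerivAt_groundInertia q l m).mulVec (T.hasDerivAt_Φ hT q l j))
  simp only [Function.update_eq_self] at hd
  refine hd.congr_deriv (Eq.symm ?_)
  by_cases hl : T.anc l m
  · rw [if_pos hl, if_pos hl]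
    -- Both `i` and `l` lie above `m`, so they are comparable. Moving `Φ_i` cancels the `crossF`
    -- term of the inertia when `l` is above `i`; for `i = l` the convention is immaterial, since `Φ
    -- × Φ = 0`. `e2` does the same for `j` and the `crossM` term.
    have e1 : ∀ f, (if T.anc l i then crossM (T.Φ q l) *ᵥ T.Φ q i else 0 : SVec) ⬝ᵥ f =
        (if T.anc i l then T.Φ q i ⬝ᵥ (crossF (T.Φ q l) *ᵥ f) else 0) -
          T.Φ q i ⬝ᵥ (crossF (T.Φ q l) *ᵥ f) := by
      intro f
      rw [dotProduct_crossF_mulVec]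
      by_cases h1 : T.anc l i <;> by_cases h2 : T.anc i l
      · obtain rfl := anc_antisymm h1 h2
        simp [crossM_mulVec_self]
      · simp [h1, h2]
      · simp [h1, h2]
      · exact absurd (anc_total hi hl) (by tauto)
    have e2 : ∀ A : SMat,
        A *ᵥ (if T.anc l j then crossM (T.Φ q l) *ᵥ T.Φ q j else 0 : SVec) =
        (A * crossM (T.Φ q l)) *ᵥ T.Φ q j -
          (if T.anc j l then (A * crossM (T.Φ q l)) *ᵥ T.Φ q j else 0) := by
      intro A
      by_cases h1 : T.anc l j <;> by_cases h2 : T.anc j l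
      · obtain rfl := anc_antisymm h1 h2
        simp [crossM_mulVec_self, ← Matrix.mulVec_mulVec]
      · simp [h1, h2]
      · simp [h1, h2]
      · exact absurd (anc_total hj hl) (by tauto)
    rw [e1, e2]
    simp only [Matrix.sub_mulVec, dotProduct_add, dotProduct_sub, Matrix.mulVec_mulVec]
    split_ifs <;> (simp; try ring)
  -- If `l` is not above `m`, then it is above neither `i` nor `j`, and nothing in the summand
  -- moves.
  · have h1 : ¬ T.anc l i := fun h => hl (anc_trans h hi)
    have h2 : ¬ T.anc l j := fun h => hl (anc_trans h hj)
    simp [hl, h1, h2]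

-- The hypothesis `ht` makes `t` the leafmost of the three indices, so the sum runs over the subtree
-- of `t` and assembles its composite inertia.
open Classical in
theorem dMass_of_leafmost (hT : ∀ (i : Fin N) (x : ℝ), HasDerivAt (T.joint i).axis 0 x)
    (q : Fin N → ℝ) {i j l t : Fin N}
    (ht : ∀ m, (T.anc i m ∧ T.anc j m ∧ T.anc l m) ↔ T.anc t m) :
    T.dMass q i j l =
      (if T.anc i l then
        T.Φ q i ⬝ᵥ ((crossF (T.Φ q l) * T.compositeInertia q t) *ᵥ T.Φ q j) else 0) -
      (if T.anc j l then
        T.Φ q i ⬝ᵥ ((T.compositeInertia q t * crossM (T.Φ q l)) *ᵥ T.Φ q j) else 0) := by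
  rw [T.dMass_eq_sum hT]
  simp only [ht, compositeInertia, Finset.mul_sum, Finset.sum_mul, Matrix.sum_mulVec,
    dotProduct_sum]
  rw [← Finset.sum_filter, Finset.sum_sub_distrib]
  split_ifs <;> simp

theorem dMass_of_not_mutuallyRelated
    (hT : ∀ (i : Fin N) (x : ℝ), HasDerivAt (T.joint i).axis 0 x)
    (q : Fin N → ℝ) {i j l : Fin N} (h : ¬ T.mutuallyRelated i j l) : T.dMass q i j l = 0 := by
  classical
  rw [T.dMass_eq_sum hT]
  refine Finset.sum_eq_zero fun m _ => if_neg fun ⟨hi, hj, hl⟩ => h ⟨?_, ?_, ?_⟩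
  exacts [anc_total hi hj, anc_total hj hl, anc_total hi hl]

variable {T} in
theorem mutuallyRelated_swap {i j k : Fin N} :
    T.mutuallyRelated i j k ↔ T.mutuallyRelated j i k := by
  simp only [mutuallyRelated, related]; tauto

variable {T} in
theorem mutuallyRelated_swap_right {i j k : Fin N} :
    T.mutuallyRelated i j k ↔ T.mutuallyRelated i k j := by
  simp only [mutuallyRelated, related]; tauto

theorem Γ_of_not_mutuallyRelated
    (hT : ∀ (i : Fin N) (x : ℝ), HasDerivAt (T.joint i).axis 0 x)
    (q : Fin N → ℝ) {i j k : Fin N} (h : ¬ T.mutuallyRelated i j k) : T.Γ q i j k = 0 := by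
  have h2 : ¬ T.mutuallyRelated i k j := mutuallyRelated_swap_right.not.1 h
  have h3 : ¬ T.mutuallyRelated j k i :=
    fun h' => h (mutuallyRelated_swap.1 (mutuallyRelated_swap_right.1 h'))
  simp [Γ, T.dMass_of_not_mutuallyRelated hT q h, T.dMass_of_not_mutuallyRelated hT q h2,
    T.dMass_of_not_mutuallyRelated hT q h3]

theorem transpose_groundInertia (q : Fin N → ℝ) (i : Fin N) :
    (T.groundInertia q i)ᵀ = T.groundInertia q i := by
  simp [groundInertia, Matrix.transpose_mul, Inertia.transpose_toMat, mul_assoc]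

theorem transpose_compositeInertia (q : Fin N → ℝ) (i : Fin N) :
    (T.compositeInertia q i)ᵀ = T.compositeInertia q i := by
  simp [compositeInertia, Matrix.transpose_sum, transpose_groundInertia]

theorem massMatrix_comm (q : Fin N → ℝ) (i j : Fin N) :
    T.massMatrix q i j = T.massMatrix q j i := by
  have h : (T.massMatrix q)ᵀ = T.massMatrix q := by
    simp [massMatrix, Matrix.transpose_sum, Matrix.transpose_mul, transpose_groundInertia,
      Matrix.mul_assoc]
  exact congrFun (congrFun h j) i

theorem dMass_comm (q : Fin N → ℝ) (i j k : Fin N) : T.dMass q i j k = T.dMass q j i k := by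
  simp only [dMass, T.massMatrix_comm _ i j]

theorem Γ_comm (q : Fin N → ℝ) (i j k : Fin N) : T.Γ q i j k = T.Γ q i k j := by
  simp only [Γ, T.dMass_comm q j k i]; ring

/-! ### Christoffel symbols along a chain -/

section Chain

variable (hT : ∀ (i : Fin N) (x : ℝ), HasDerivAt (T.joint i).axis 0 x) (q : Fin N → ℝ)
  {i j k : Fin N} (hij : T.anc i j) (hjk : T.anc j k)
include hT hij hjk

theorem dMass_leaf :
    T.dMass q i j k =
      T.Φ q i ⬝ᵥ ((crossF (T.Φ q k) * T.compositeInertia q k) *ᵥ T.Φ q j) -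
      T.Φ q i ⬝ᵥ ((T.compositeInertia q k * crossM (T.Φ q k)) *ᵥ T.Φ q j) := by
  rw [T.dMass_of_leafmost hT q (t := k) fun m => ⟨fun h => h.2.2, fun h =>
    ⟨anc_trans hij (anc_trans hjk h), anc_trans hjk h, h⟩⟩,
    if_pos (anc_trans hij hjk), if_pos hjk]

/-- Only the root-side index is above `j`, so one `crossF` term survives; `crossBar` exchanges its
two arguments to put `Φ_j` on the right. In the tie `j = k` the other term contains `Φ_k × Φ_k = 0`.
-/
theorem dMass_middle :
    T.dMass q i k j =
      T.Φ q i ⬝ᵥ (crossBar (T.compositeInertia q k *ᵥ T.Φ q k) *ᵥ T.Φ q j) := by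
  classical
  rw [T.dMass_of_leafmost hT q (t := k) fun m => ⟨fun h => h.2.1, fun h =>
    ⟨anc_trans hij (anc_trans hjk h), h, anc_trans hjk h⟩⟩, if_pos hij, crossBar_mulVec,
    Matrix.mulVec_mulVec, sub_eq_self]
  split_ifs with h
  · obtain rfl := anc_antisymm hjk h
    simp [← Matrix.mulVec_mulVec, crossM_mulVec_self]
  · rfl

/-- Turning joint `i` moves both axes and all relevant inertias together, and a rigid motion
preserves the pairing. -/
theorem dMass_root : T.dMass q j k i = 0 := by
  classical
  rw [T.dMass_of_leafmost hT q (t := k) fun m => ⟨fun h => h.2.1, fun h =>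
    ⟨anc_trans hjk h, h, anc_trans hij (anc_trans hjk h)⟩⟩]
  have h1 : (if T.anc j i then
        T.Φ q j ⬝ᵥ ((crossF (T.Φ q i) * T.compositeInertia q k) *ᵥ T.Φ q k) else 0) = 0 := by
    split_ifs with h
    · obtain rfl := anc_antisymm hij h
      rw [← Matrix.mulVec_mulVec, dotProduct_crossF_mulVec, crossM_mulVec_self]
      simp
    · rfl
  have h2 : (if T.anc k i then
        T.Φ q j ⬝ᵥ ((T.compositeInertia q k * crossM (T.Φ q i)) *ᵥ T.Φ q k) else 0) = 0 := by
    split_ifs with h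
    · obtain rfl := anc_antisymm (anc_trans hij hjk) h
      simp [← Matrix.mulVec_mulVec, crossM_mulVec_self]
    · rfl
  rw [h1, h2, sub_zero]

theorem Γ_root :
    T.Γ q i j k = T.Φ q i ⬝ᵥ (bodyB (T.Φ q k) (T.compositeInertia q k) *ᵥ T.Φ q j) := by
  rw [Γ, T.dMass_leaf hT q hij hjk, T.dMass_middle hT q hij hjk, T.dMass_root hT q hij hjk, bodyB]
  simp only [Matrix.smul_mulVec, Matrix.add_mulVec, Matrix.sub_mulVec, dotProduct_smul,
    dotProduct_add, dotProduct_sub, smul_eq_mul]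
  ring

theorem Γ_leaf :
    T.Γ q k i j = (1 / 2 : ℝ) * (T.Φ q i ⬝ᵥ
      ((T.compositeInertia q k * crossM (T.Φ q k) - crossF (T.Φ q k) * T.compositeInertia q k
        + crossBar (T.compositeInertia q k *ᵥ T.Φ q k)) *ᵥ T.Φ q j)) := by
  rw [Γ, T.dMass_leaf hT q hij hjk, T.dMass_comm q k i j, T.dMass_middle hT q hij hjk,
    T.dMass_comm q k j i, T.dMass_root hT q hij hjk]
  simp only [Matrix.add_mulVec, Matrix.sub_mulVec, dotProduct_add, dotProduct_sub]
  ring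

theorem Γ_leaf_eq_crossBar_sub_bodyB :
    T.Γ q k i j = T.Φ q i ⬝ᵥ ((crossBar (T.compositeInertia q k *ᵥ T.Φ q k)
      - bodyB (T.Φ q k) (T.compositeInertia q k)) *ᵥ T.Φ q j) := by
  rw [T.Γ_leaf hT q hij hjk, bodyB]
  simp only [Matrix.smul_mulVec, Matrix.add_mulVec, Matrix.sub_mulVec, dotProduct_smul,
    dotProduct_add, dotProduct_sub, smul_eq_mul]
  ring

end Chain

end RigidTree

/-! ### Adjoint identities for a symmetric operator -/

theorem dotProduct_mulVec_comm (A : SMat) (u v : SVec) : u ⬝ᵥ (A *ᵥ v) = v ⬝ᵥ (Aᵀ *ᵥ u) := by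
  rw [Matrix.dotProduct_mulVec, dotProduct_comm, Matrix.mulVec_transpose]

theorem transpose_crossF_mul {J : SMat} (hJ : Jᵀ = J) (v : SVec) :
    (crossF v * J)ᵀ = -(J * crossM v) := by
  rw [Matrix.transpose_mul, hJ, crossF, Matrix.transpose_neg, Matrix.transpose_transpose, mul_neg]

theorem transpose_mul_crossM {J : SMat} (hJ : Jᵀ = J) (v : SVec) :
    (J * crossM v)ᵀ = -(crossF v * J) := by
  rw [Matrix.transpose_mul, hJ, crossF, neg_mul, neg_neg]

/-- The bilinear form of `B(v, I)` in terms of its first and third argument. -/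
theorem dotProduct_bodyB_mulVec_eq {J : SMat} (hJ : Jᵀ = J) (u v w : SVec) :
    u ⬝ᵥ (bodyB v J *ᵥ w) =
      w ⬝ᵥ ((crossBar (J *ᵥ u) - bodyB u J) *ᵥ v) := by
  -- The exchange permutes the three terms of `B`: first to third, second to first, third to second.
  have h1 : u ⬝ᵥ ((crossF v * J) *ᵥ w) = w ⬝ᵥ ((J * crossM u) *ᵥ v) := by
    rw [dotProduct_mulVec_comm, transpose_crossF_mul hJ, Matrix.neg_mulVec, dotProduct_neg,
      ← Matrix.mulVec_mulVec, ← Matrix.mulVec_mulVec, crossM_mulVec_comm v u, Matrix.mulVec_neg,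
      dotProduct_neg, neg_neg]
  have h2 : u ⬝ᵥ (crossBar (J *ᵥ v) *ᵥ w) = -(w ⬝ᵥ ((crossF u * J) *ᵥ v)) := by
    rw [crossBar_mulVec, dotProduct_crossF_mulVec, ← Matrix.mulVec_mulVec,
      dotProduct_crossF_mulVec, crossM_mulVec_comm w u, neg_dotProduct]
  have h3 : u ⬝ᵥ ((J * crossM v) *ᵥ w) = -(w ⬝ᵥ (crossBar (J *ᵥ u) *ᵥ v)) := by
    rw [dotProduct_mulVec_comm, transpose_mul_crossM hJ, Matrix.neg_mulVec, dotProduct_neg,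
      crossBar_mulVec, Matrix.mulVec_mulVec]
  rw [bodyB, bodyB]
  simp only [Matrix.smul_mulVec, Matrix.add_mulVec, Matrix.sub_mulVec, dotProduct_smul,
    dotProduct_add, dotProduct_sub, smul_eq_mul, h1, h2, h3]
  ring

/-! ### The other index orders and the closed form -/

namespace RigidTree

variable {N : ℕ} (T : RigidTree N) (hT : ∀ (i : Fin N) (x : ℝ), HasDerivAt (T.joint i).axis 0 x)
  (q : Fin N → ℝ) {i j k : Fin N}
include hT

theorem Γ_leaf_eq_bodyB (hij : T.anc i j) (hjk : T.anc j k) :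
    T.Γ q k i j = T.Φ q k ⬝ᵥ (bodyB (T.Φ q j) (T.compositeInertia q k) *ᵥ T.Φ q i) := by
  rw [T.Γ_leaf_eq_crossBar_sub_bodyB hT q hij hjk,
    dotProduct_bodyB_mulVec_eq (T.transpose_compositeInertia q k)]

/-- Here `∂M_ik/∂q_j` enters with the opposite sign. Transposing `B` has the same effect: `(v ×*) I
- I (v ×)` is symmetric and the `crossBar` part is skew. -/
theorem Γ_middle (hij : T.anc i j) (hjk : T.anc j k) :
    T.Γ q j i k = T.Φ q j ⬝ᵥ (bodyB (T.Φ q k) (T.compositeInertia q k) *ᵥ T.Φ q i) := by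
  have h1 : T.Φ q j ⬝ᵥ ((crossF (T.Φ q k) * T.compositeInertia q k) *ᵥ T.Φ q i) =
      -(T.Φ q i ⬝ᵥ ((T.compositeInertia q k * crossM (T.Φ q k)) *ᵥ T.Φ q j)) := by
    rw [dotProduct_mulVec_comm, transpose_crossF_mul (T.transpose_compositeInertia q k),
      Matrix.neg_mulVec, dotProduct_neg]
  have h2 : T.Φ q j ⬝ᵥ ((T.compositeInertia q k * crossM (T.Φ q k)) *ᵥ T.Φ q i) =
      -(T.Φ q i ⬝ᵥ ((crossF (T.Φ q k) * T.compositeInertia q k) *ᵥ T.Φ q j)) := by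
    rw [dotProduct_mulVec_comm, transpose_mul_crossM (T.transpose_compositeInertia q k),
      Matrix.neg_mulVec, dotProduct_neg]
  have h3 : T.Φ q j ⬝ᵥ (crossBar (T.compositeInertia q k *ᵥ T.Φ q k) *ᵥ T.Φ q i) =
      -(T.Φ q i ⬝ᵥ (crossBar (T.compositeInertia q k *ᵥ T.Φ q k) *ᵥ T.Φ q j)) := by
    rw [dotProduct_mulVec_comm, transpose_crossBar, Matrix.neg_mulVec, dotProduct_neg]
  rw [Γ, T.dMass_comm q j i k, T.dMass_leaf hT q hij hjk, T.dMass_root hT q hij hjk,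
    T.dMass_middle hT q hij hjk, bodyB]
  simp only [Matrix.smul_mulVec, Matrix.add_mulVec, Matrix.sub_mulVec, dotProduct_smul,
    dotProduct_add, dotProduct_sub, smul_eq_mul, h1, h2, h3]
  ring

theorem Γ_eq_bodyB_leafmost (h : T.mutuallyRelated i j k) (hjk : T.anc j k) :
    T.Γ q i j k = T.Φ q i ⬝ᵥ
      (bodyB (T.Φ q k) (T.compositeInertia q (T.leafmost (T.leafmost i j) k)) *ᵥ T.Φ q j) := by
  classical
  -- As `j ⪯ k`, the leafmost index is `i` or `k`. If it is `k`, the order of `i` and `j` decides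
  -- between `Γ_root` and `Γ_middle`.
  have key : T.anc k i ∧ T.leafmost (T.leafmost i j) k = i ∨
      T.anc i k ∧ T.leafmost (T.leafmost i j) k = k := by
    rcases h.2.2 with hik | hki
    · right
      refine ⟨hik, ?_⟩
      unfold leafmost
      split_ifs with h1 h2 h2
      · exact anc_antisymm hik h2
      · rfl
      · exact anc_antisymm hjk h2
      · rfl
    · left
      refine ⟨hki, ?_⟩
      rw [leafmost, leafmost, if_pos (anc_trans hjk hki), if_pos hki]
  rcases key with ⟨hki, e⟩ | ⟨hik, e⟩ <;> rw [e]
  · exact T.Γ_leaf_eq_bodyB hT q hjk hki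
  · rcases h.1 with hij | hji
    · exact T.Γ_root hT q hij hjk
    · exact T.Γ_middle hT q hji hik

end RigidTree

/-! ### Timed computations -/

namespace Timed

variable {α β : Type}

theorem val_bind (x : Timed α) (f : α → Timed β) : (x >>= f).val = (f x.val).val := rfl

theorem cost_bind (x : Timed α) (f : α → Timed β) :
    (x >>= f).cost = x.cost + (f x.val).cost := rfl

theorem val_pure (a : α) : (pure a : Timed α).val = a := rfl

theorem cost_pure (a : α) : (pure a : Timed α).cost = 0 := rfl

theorem val_foldlM (f : β → α → Timed β) (s : β) (l : List α) :
    (l.foldlM f s).val = l.foldl (fun s a => (f s a).val) s := by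
  induction l generalizing s with
  | nil => rfl
  | cons a l ih => rw [List.foldlM_cons, val_bind, ih, List.foldl_cons]

theorem cost_foldlM_le {f : β → α → Timed β} {c : ℕ} (hf : ∀ s a, (f s a).cost ≤ c) (s : β)
    (l : List α) : (l.foldlM f s).cost ≤ l.length * c := by
  induction l generalizing s with
  | nil => exact Nat.zero_le _
  | cons a l ih =>
    rw [List.foldlM_cons, cost_bind, List.length_cons]
    have := hf s a
    have := ih (f s a).val
    linarith

end Timed

/-! ### Filling an array of symbols -/

section Fill

variable {N : ℕ}

/-- `(a, b, c)` is a permutation of `(i, j, k)`. -/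
def IsPermOf (i j k a b c : Fin N) : Prop :=
  (a = i ∧ b = j ∧ c = k) ∨ (a = i ∧ b = k ∧ c = j) ∨ (a = j ∧ b = i ∧ c = k) ∨
    (a = j ∧ b = k ∧ c = i) ∨ (a = k ∧ b = i ∧ c = j) ∨ (a = k ∧ b = j ∧ c = i)

open Classical in
/-- The array that agrees with `H` on `S` and with `G` elsewhere. -/
def fillOn (S : Fin N → Fin N → Fin N → Prop) (H G : Fin N → Fin N → Fin N → ℝ) :
    Fin N → Fin N → Fin N → ℝ :=
  fun a b c => if S a b c then H a b c else G a b c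

/-- Overwriting is harmless because every write takes its value from the same array `H`. -/
theorem fillOn_fillOn (S S' : Fin N → Fin N → Fin N → Prop) (H G : Fin N → Fin N → Fin N → ℝ) :
    fillOn S H (fillOn S' H G) = fillOn (fun a b c => S a b c ∨ S' a b c) H G := by
  funext a b c
  by_cases h : S a b c <;> by_cases h' : S' a b c <;> simp [fillOn, h, h']

theorem fillOn_congr {S S' : Fin N → Fin N → Fin N → Prop} (h : ∀ a b c, S a b c ↔ S' a b c)
    (H G : Fin N → Fin N → Fin N → ℝ) : fillOn S H G = fillOn S' H G := by
  obtain rfl : S = S' := by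
    funext a b c
    exact propext (h a b c)
  rfl

/-- The assignment of the symbols of all permutations of `(i, j, k)`. -/
def assignSix (G : Fin N → Fin N → Fin N → ℝ) (i j k : Fin N) (g₁ g₂ g₃ : ℝ) :
    Fin N → Fin N → Fin N → ℝ :=
  fun a b c =>
    if a = k ∧ b = j ∧ c = i then g₃ else if a = k ∧ b = i ∧ c = j then g₃ else
    if a = j ∧ b = k ∧ c = i then g₂ else if a = j ∧ b = i ∧ c = k then g₂ else
    if a = i ∧ b = k ∧ c = j then g₁ else if a = i ∧ b = j ∧ c = k then g₁ else G a b c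

/-- With repeated indices several writes hit one entry; they agree, all being entries of `H`. The
branches of `assignSix` test the last write first, matching the order of assignments in `loopI`. -/
theorem assignSix_eq_fillOn {H : Fin N → Fin N → Fin N → ℝ} (hH : ∀ a b c, H a b c = H a c b)
    (G : Fin N → Fin N → Fin N → ℝ) (i j k : Fin N) :
    assignSix G i j k (H i j k) (H j i k) (H k i j) = fillOn (IsPermOf i j k) H G := by
  funext a b c
  by_cases h : IsPermOf i j k a b c
  · rw [fillOn, if_pos h, assignSix]
    split_ifs with h1 h2 h3 h4 h5 h6
    · obtain ⟨rfl, rfl, rfl⟩ := h1; exact hH _ _ _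
    · obtain ⟨rfl, rfl, rfl⟩ := h2; rfl
    · obtain ⟨rfl, rfl, rfl⟩ := h3; exact hH _ _ _
    · obtain ⟨rfl, rfl, rfl⟩ := h4; rfl
    · obtain ⟨rfl, rfl, rfl⟩ := h5; exact hH _ _ _
    · obtain ⟨rfl, rfl, rfl⟩ := h6; rfl
    · rcases h with h | h | h | h | h | h
      exacts [absurd h ‹_›, absurd h ‹_›, absurd h ‹_›, absurd h ‹_›, absurd h ‹_›, absurd h ‹_›]
  · rw [fillOn, if_neg h, assignSix]
    simp only [IsPermOf, not_or] at h
    obtain ⟨h1, h2, h3, h4, h5, h6⟩ := h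
    simp only [h1, h2, h3, h4, h5, h6, if_false]

end Fill

namespace RigidTree

variable {N : ℕ} (T : RigidTree N)

/-! ### Composite inertias in body coordinates -/

variable {T} in
theorem Xinv_parent {i p : Fin N} (h : T.parent i = some p) (q : Fin N → ℝ) :
    (T.pose q p).Xinv = (T.pose q i).Xinv * T.X q i := by
  rw [pose_of_some h, Pose.Xinv_comp, X, mul_assoc, Pose.Xinv_mul_X, mul_one]

variable {T} in
theorem congr_parent {i p : Fin N} (h : T.parent i = some p) (q : Fin N → ℝ) (A : SMat) :
    (T.X q i)ᵀ * ((T.pose q i).Xinvᵀ * A * (T.pose q i).Xinv) * T.X q i =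
      (T.pose q p).Xinvᵀ * A * (T.pose q p).Xinv := by
  rw [Xinv_parent h, Matrix.transpose_mul]
  simp only [mul_assoc]

variable {T} in
theorem forceBack_parent {i p : Fin N} (h : T.parent i = some p) (q : Fin N → ℝ) (f : SVec) :
    (T.X q i)ᵀ *ᵥ ((T.pose q i).Xinvᵀ *ᵥ f) = (T.pose q p).Xinvᵀ *ᵥ f := by
  rw [Xinv_parent h, Matrix.transpose_mul, Matrix.mulVec_mulVec]

theorem groundInertia_congr (q : Fin N → ℝ) (i : Fin N) :
    (T.pose q i).Xinvᵀ * T.groundInertia q i * (T.pose q i).Xinv = (T.inertia i).toMat := by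
  have h : (T.pose q i).Xinvᵀ * (T.pose q i).Xᵀ = 1 := by
    rw [← Matrix.transpose_mul, Pose.X_mul_Xinv, Matrix.transpose_one]
  rw [groundInertia, ← mul_assoc, ← mul_assoc, h, one_mul, mul_assoc, Pose.X_mul_Xinv, mul_one]

-- Every proper descendant of `k` lies below exactly one child: two children above the same body are
-- comparable, and a child cannot be above its sibling.
open Classical in
theorem compositeInertia_eq_add_children (q : Fin N → ℝ) (k : Fin N) :
    T.compositeInertia q k = T.groundInertia q k +
      ∑ c with T.parent c = some k, T.compositeInertia q c := by
  have hchild : ∀ m, (∑ c, if T.parent c = some k then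
      (if T.anc c m then T.groundInertia q m else 0) else 0) =
      if T.anc k m ∧ m ≠ k then T.groundInertia q m else 0 := by
    intro m
    split_ifs with h
    · obtain ⟨c, hc, hck⟩ := (Relation.ReflTransGen.cases_tail h.1).resolve_left (Ne.symm h.2)
      rw [Finset.sum_eq_single c]
      · rw [if_pos hck, if_pos (show T.anc c m from hc)]
      · intro c' _ hne
        split_ifs with h1 h2
        · exfalso
          rcases anc_total (show T.anc c m from hc) h2 with h3 | h3
          · rcases (anc_iff_of_some h1 c).1 h3 with rfl | h4
            · exact hne rfl
            · exact not_anc_parent hck h4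
          · rcases (anc_iff_of_some hck c').1 h3 with rfl | h4
            · exact hne rfl
            · exact not_anc_parent h1 h4
        all_goals rfl
      · simp
    · refine Finset.sum_eq_zero fun c _ => ?_
      split_ifs with h1 h2
      · exfalso
        refine h ⟨anc_trans ((anc_iff_of_some h1 k).2 (Or.inr (T.anc_refl k))) h2, ?_⟩
        rintro rfl
        exact not_anc_parent h1 h2
      all_goals rfl
  simp only [compositeInertia, Finset.sum_filter]
  have hswap : (∑ c, if T.parent c = some k then
      (∑ m, if T.anc c m then T.groundInertia q m else 0) else 0) =
      ∑ m, if T.anc k m ∧ m ≠ k then T.groundInertia q m else 0 := by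
    simp only [← hchild]
    rw [Finset.sum_comm]
    refine Finset.sum_congr rfl fun c _ => ?_
    split_ifs <;> simp
  rw [hswap, ← Finset.add_sum_erase _ _ (Finset.mem_univ k), if_pos (T.anc_refl k),
    ← Finset.add_sum_erase (a := k) _ (fun m => if T.anc k m ∧ m ≠ k then _ else _)
      (Finset.mem_univ k)]
  simp only [ne_eq, not_true_eq_false, and_false, if_false, zero_add]
  refine congrArg _ (Finset.sum_congr rfl fun m hm => ?_)
  simp [Finset.ne_of_mem_erase hm]

/-! ### The inner loops -/

section Loops

variable (q : Fin N → ℝ)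

variable {T} in
theorem loopI_of_none {i : Fin N} (h : T.parent i = none) (j k : Fin N) (F₁ F₂ F₃ : SVec)
    (G : Fin N → Fin N → Fin N → ℝ) :
    (T.loopI q j k i F₁ F₂ F₃ G).val =
      assignSix G i j k ((T.joint i).axis (q i) ⬝ᵥ F₁) ((T.joint i).axis (q i) ⬝ᵥ F₂)
        ((T.joint i).axis (q i) ⬝ᵥ F₃) ∧
      (T.loopI q j k i F₁ F₂ F₃ G).cost = 346 := by
  rw [loopI]
  split
  · refine ⟨rfl, ?_⟩
    -- Three dot products, six assignments, three force transforms and one lookup: `33 + 6 + 306 +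
    -- 1`.
    have : 11 + (1 + (1 + (11 + (1 + (1 + (11 + (1 + (1 + (36 + 66 + (36 + 66 + (36 + 66 +
      (1 + 0)))))))))))) = 346 := by norm_num
    exact this
  · simp_all

variable {T} in
theorem loopI_of_some {i p : Fin N} (h : T.parent i = some p) (j k : Fin N) (F₁ F₂ F₃ : SVec)
    (G : Fin N → Fin N → Fin N → ℝ) :
    let r := T.loopI q j k p ((T.X q i)ᵀ *ᵥ F₁) ((T.X q i)ᵀ *ᵥ F₂) ((T.X q i)ᵀ *ᵥ F₃)
      (assignSix G i j k ((T.joint i).axis (q i) ⬝ᵥ F₁) ((T.joint i).axis (q i) ⬝ᵥ F₂)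
        ((T.joint i).axis (q i) ⬝ᵥ F₃))
    (T.loopI q j k i F₁ F₂ F₃ G).val = r.val ∧
      (T.loopI q j k i F₁ F₂ F₃ G).cost = 346 + r.cost := by
  intro r
  rw [loopI]
  split
  · simp_all
  · rename_i p' h'
    obtain rfl : p' = p := Option.some.inj (h'.symm.trans h)
    refine ⟨rfl, ?_⟩
    have : ∀ n, 11 + (1 + (1 + (11 + (1 + (1 + (11 + (1 + (1 + (36 + 66 + (36 + 66 + (36 + 66 +
      (1 + n)))))))))))) = 346 + n := fun n => by omega
    exact this r.cost

variable {T} in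
theorem loopJ_of_none {j : Fin N} (h : T.parent j = none) (k : Fin N) (B D : SMat)
    (G : Fin N → Fin N → Fin N → ℝ) :
    let r := T.loopI q j k j (B *ᵥ (T.joint j).axis (q j)) (Bᵀ *ᵥ (T.joint j).axis (q j))
      (D *ᵥ (T.joint j).axis (q j)) G
    (T.loopJ q k j B D G).val = r.val ∧ (T.loopJ q k j B D G).cost = 1891 + r.cost := by
  intro r
  rw [loopJ]
  split
  · refine ⟨rfl, ?_⟩
    -- Three matrix-vector products and a transpose cost `234`, two congruences `1656`, the lookup
    -- `1`.
    have : ∀ n, 66 + (36 + (66 + (66 + (n + (36 + (396 + 396) + (36 + (396 + 396) +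
      (1 + 0))))))) = 1891 + n := fun n => by omega
    exact this r.cost
  · simp_all

variable {T} in
theorem loopJ_of_some {j p : Fin N} (h : T.parent j = some p) (k : Fin N) (B D : SMat)
    (G : Fin N → Fin N → Fin N → ℝ) :
    let r := T.loopI q j k j (B *ᵥ (T.joint j).axis (q j)) (Bᵀ *ᵥ (T.joint j).axis (q j))
      (D *ᵥ (T.joint j).axis (q j)) G
    let s := T.loopJ q k p ((T.X q j)ᵀ * B * T.X q j) ((T.X q j)ᵀ * D * T.X q j) r.val
    (T.loopJ q k j B D G).val = s.val ∧
      (T.loopJ q k j B D G).cost = 1891 + r.cost + s.cost := by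
  intro r s
  rw [loopJ]
  split
  · simp_all
  · rename_i p' h'
    obtain rfl : p' = p := Option.some.inj (h'.symm.trans h)
    refine ⟨rfl, ?_⟩
    have : ∀ n m, 66 + (36 + (66 + (66 + (n + (36 + (396 + 396) + (36 + (396 + 396) +
      (1 + m))))))) = 1891 + n + m := fun n m => by omega
    exact this r.cost s.cost

theorem passK_eq (s : (Option (Fin N) → SMat) × (Fin N → Fin N → Fin N → ℝ)) (k : Fin N) :
    let J := s.1 (some k)
    let φ := (T.joint k).axis (q k)
    let r := T.loopJ q k k (bodyB φ J) (crossBar (J *ᵥ φ) - bodyB φ J) s.2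
    (T.passK q s k).val = (Function.update s.1 (T.parent k)
        (s.1 (T.parent k) + (T.X q k)ᵀ * J * T.X q k), r.val) ∧
      (T.passK q s k).cost = 2011 + r.cost := by
  intro J φ r
  have hr : T.passK q s k = ⟨(Function.update s.1 (T.parent k)
      (s.1 (T.parent k) + (T.X q k)ᵀ * J * T.X q k), r.val),
      36 + (396 + (66 + (36 + (36 + (396 + (36 + (36 + (36 + (36 + (r.cost +
        (36 + (396 + 396) + (1 + (36 + (36 + 0))))))))))))))⟩ := rfl
  rw [hr]
  refine ⟨rfl, ?_⟩
  dsimp only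
  omega

/-! ### Cost of the loops -/

open Classical in
/-- The number of bodies on the path from body `i` to the root. -/
def level (i : Fin N) : ℕ := (Finset.univ.filter fun j : Fin N => T.anc j i).card

theorem level_le_depth (i : Fin N) : T.level i ≤ T.depth := by
  classical
  exact Finset.le_sup (f := fun i : Fin N => (Finset.univ.filter fun j : Fin N => T.anc j i).card)
    (Finset.mem_univ i)

theorem level_pos (i : Fin N) : 0 < T.level i :=
  Finset.card_pos.2 ⟨i, by simp [T.anc_refl]⟩

variable {T} in
theorem level_of_some {i p : Fin N} (h : T.parent i = some p) : T.level i = 1 + T.level p := by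
  classical
  have : (Finset.univ.filter fun j : Fin N => T.anc j i) =
      insert i (Finset.univ.filter fun j : Fin N => T.anc j p) := by
    ext j; simp [anc_iff_of_some h]
  rw [level, level, this, Finset.card_insert_of_notMem (by simp [not_anc_parent h]), add_comm]

theorem cost_loopI_le (j k i : Fin N) (F₁ F₂ F₃ : SVec) (G : Fin N → Fin N → Fin N → ℝ) :
    (T.loopI q j k i F₁ F₂ F₃ G).cost ≤ 346 * T.level i := by
  induction i using T.parent_induction generalizing F₁ F₂ F₃ G with
  | none i h =>
    rw [(loopI_of_none q h j k F₁ F₂ F₃ G).2]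
    exact Nat.le_mul_of_pos_right _ (T.level_pos i)
  | some i p h ih =>
    rw [(loopI_of_some q h j k F₁ F₂ F₃ G).2, level_of_some h, mul_add]
    exact Nat.add_le_add_left (ih _ _ _ _) _

theorem cost_loopJ_le (k j : Fin N) (B D : SMat) (G : Fin N → Fin N → Fin N → ℝ) :
    (T.loopJ q k j B D G).cost ≤ T.level j * (1891 + 346 * T.depth) := by
  have hI : ∀ j F₁ F₂ F₃ G, (T.loopI q j k j F₁ F₂ F₃ G).cost ≤ 346 * T.depth :=
    fun j F₁ F₂ F₃ G => (T.cost_loopI_le q j k j F₁ F₂ F₃ G).trans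
      (Nat.mul_le_mul_left _ (T.level_le_depth j))
  induction j using T.parent_induction generalizing B D G with
  | none j h =>
    rw [(loopJ_of_none q h k B D G).2]
    exact (Nat.add_le_add_left (hI _ _ _ _ _) _).trans (Nat.le_mul_of_pos_left _ (T.level_pos j))
  | some j p h ih =>
    rw [(loopJ_of_some q h k B D G).2, level_of_some h, add_mul, one_mul]
    exact Nat.add_le_add (Nat.add_le_add_left (hI _ _ _ _ _) _) (ih _ _ _)

/-- The constant is `2011 + 1891 + 346`; the lower-order terms are absorbed using depth at least
`1`. -/
theorem cost_passK_le (s : (Option (Fin N) → SMat) × (Fin N → Fin N → Fin N → ℝ)) (k : Fin N) :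
    (T.passK q s k).cost ≤ 4248 * T.depth ^ 2 := by
  rw [(T.passK_eq q s k).2]
  have h1 := T.cost_loopJ_le q k k (bodyB ((T.joint k).axis (q k)) (s.1 (some k)))
    (crossBar (s.1 (some k) *ᵥ (T.joint k).axis (q k)) -
      bodyB ((T.joint k).axis (q k)) (s.1 (some k))) s.2
  have h2 := T.level_le_depth k
  have h3 := T.level_pos k
  have h4 := Nat.mul_le_mul_right (1891 + 346 * T.depth) h2
  nlinarith

/-- Initialization adds `36` per body to the `4248 d²` of a pass. -/
theorem cost_christoffelAlgorithm_le :
    (T.christoffelAlgorithm q).cost ≤ 4284 * (N * T.depth ^ 2) := by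
  have h1 : ∀ IC : Option (Fin N) → SMat, ((List.finRange N).foldlM
      (fun IC i => Timed.assignMat IC (some i) (T.inertia i).toMat) IC).cost ≤ N * 36 := fun IC => by
    simpa using Timed.cost_foldlM_le (c := 36)
      (f := fun IC i => Timed.assignMat IC (some i) (T.inertia i).toMat)
      (fun _ _ => le_rfl) IC (List.finRange N)
  have h2 : ∀ s, ((List.finRange N).reverse.foldlM (T.passK q) s).cost ≤
      N * (4248 * T.depth ^ 2) := fun s => by
    simpa using Timed.cost_foldlM_le (T.cost_passK_le q) s (List.finRange N).reverse
  have h3 : N ≤ N * T.depth ^ 2 := by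
    rcases Nat.eq_zero_or_pos N with h | h
    · simp [h]
    · exact Nat.le_mul_of_pos_right _
        (pow_pos ((T.level_pos ⟨0, h⟩).trans_le (T.level_le_depth _)) 2)
  rw [christoffelAlgorithm]
  simp only [Timed.cost_bind, Timed.cost_pure, add_zero]
  refine (Nat.add_le_add (h1 _) (h2 _)).trans ?_
  linarith

/-! ### Correctness of the loops -/

theorem axis_dotProduct (i : Fin N) (f : SVec) :
    (T.joint i).axis (q i) ⬝ᵥ ((T.pose q i).Xinvᵀ *ᵥ f) = T.Φ q i ⬝ᵥ f := by
  rw [Matrix.mulVec_transpose, ← dotProduct_comm, ← Matrix.dotProduct_mulVec, dotProduct_comm]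
  rfl

theorem congr_mulVec_axis (i : Fin N) (A : SMat) :
    ((T.pose q i).Xinvᵀ * A * (T.pose q i).Xinv) *ᵥ (T.joint i).axis (q i) =
      (T.pose q i).Xinvᵀ *ᵥ (A *ᵥ T.Φ q i) := by
  simp only [Φ, Matrix.mulVec_mulVec, mul_assoc]

variable (hT : ∀ (i : Fin N) (x : ℝ), HasDerivAt (T.joint i).axis 0 x)
include hT

/-- The three force vectors are fixed in ground coordinates and merely re-expressed at each
predecessor, so pairing with the local axis gives the chain formulas. -/
theorem val_loopI {i j k : Fin N} (hij : T.anc i j) (hjk : T.anc j k)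
    (G : Fin N → Fin N → Fin N → ℝ) :
    (T.loopI q j k i
      ((T.pose q i).Xinvᵀ *ᵥ (bodyB (T.Φ q k) (T.compositeInertia q k) *ᵥ T.Φ q j))
      ((T.pose q i).Xinvᵀ *ᵥ ((bodyB (T.Φ q k) (T.compositeInertia q k))ᵀ *ᵥ T.Φ q j))
      ((T.pose q i).Xinvᵀ *ᵥ ((crossBar (T.compositeInertia q k *ᵥ T.Φ q k) -
        bodyB (T.Φ q k) (T.compositeInertia q k)) *ᵥ T.Φ q j)) G).val =
      fillOn (fun a b c => ∃ i', T.anc i' i ∧ IsPermOf i' j k a b c) (T.Γ q) G := by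
  have hsix : ∀ {i : Fin N}, T.anc i j → ∀ G : Fin N → Fin N → Fin N → ℝ, assignSix G i j k
      (T.Φ q i ⬝ᵥ (bodyB (T.Φ q k) (T.compositeInertia q k) *ᵥ T.Φ q j))
      (T.Φ q i ⬝ᵥ ((bodyB (T.Φ q k) (T.compositeInertia q k))ᵀ *ᵥ T.Φ q j))
      (T.Φ q i ⬝ᵥ ((crossBar (T.compositeInertia q k *ᵥ T.Φ q k) -
        bodyB (T.Φ q k) (T.compositeInertia q k)) *ᵥ T.Φ q j)) =
      fillOn (IsPermOf i j k) (T.Γ q) G := fun hij G => by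
    rw [← assignSix_eq_fillOn (T.Γ_comm q), T.Γ_root hT q hij hjk, T.Γ_middle hT q hij hjk,
      T.Γ_leaf_eq_crossBar_sub_bodyB hT q hij hjk, ← dotProduct_mulVec_comm]
  induction i using T.parent_induction generalizing G with
  | none i h =>
    rw [(loopI_of_none q h j k _ _ _ G).1]
    simp only [axis_dotProduct]
    rw [hsix hij]
    exact fillOn_congr (fun a b c => by simp [anc_iff_of_none h]) _ _
  | some i p h ih =>
    rw [(loopI_of_some q h j k _ _ _ G).1]
    simp only [axis_dotProduct, forceBack_parent h]
    rw [hsix hij, ih (anc_trans ((anc_iff_of_some h p).2 (Or.inr (T.anc_refl p))) hij),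
      fillOn_fillOn]
    refine fillOn_congr (fun a b c => ?_) _ _
    simp only [anc_iff_of_some h, or_and_right, exists_or, exists_eq_left]
    exact or_comm

theorem val_loopJ {j k : Fin N} (hjk : T.anc j k) (G : Fin N → Fin N → Fin N → ℝ) :
    (T.loopJ q k j
      ((T.pose q j).Xinvᵀ * bodyB (T.Φ q k) (T.compositeInertia q k) * (T.pose q j).Xinv)
      ((T.pose q j).Xinvᵀ * (crossBar (T.compositeInertia q k *ᵥ T.Φ q k) -
        bodyB (T.Φ q k) (T.compositeInertia q k)) * (T.pose q j).Xinv) G).val =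
      fillOn (fun a b c => ∃ j', T.anc j' j ∧ ∃ i', T.anc i' j' ∧ IsPermOf i' j' k a b c)
        (T.Γ q) G := by
  have htr : ∀ (P : Pose) (A : SMat), (P.Xinvᵀ * A * P.Xinv)ᵀ = P.Xinvᵀ * Aᵀ * P.Xinv :=
    fun P A => by
      simp only [Matrix.transpose_mul, Matrix.transpose_transpose, mul_assoc]
  induction j using T.parent_induction generalizing G with
  | none j h =>
    rw [(loopJ_of_none q h k _ _ G).1]
    simp only [htr, congr_mulVec_axis]
    rw [T.val_loopI q hT (T.anc_refl j) hjk]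
    exact fillOn_congr (fun a b c => by simp [anc_iff_of_none h]) _ _
  | some j p h ih =>
    rw [(loopJ_of_some q h k _ _ G).1]
    simp only [htr, congr_mulVec_axis, congr_parent h]
    rw [T.val_loopI q hT (T.anc_refl j) hjk,
      ih (anc_trans ((anc_iff_of_some h p).2 (Or.inr (T.anc_refl p))) hjk), fillOn_fillOn]
    refine fillOn_congr (fun a b c => ?_) _ _
    simp only [anc_iff_of_some h, or_and_right (c := ∃ i', _), exists_or, exists_eq_left]
    exact or_comm

theorem val_passK {k : Fin N} (s : (Option (Fin N) → SMat) × (Fin N → Fin N → Fin N → ℝ))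
    (hs : s.1 (some k) =
      (T.pose q k).Xinvᵀ * T.compositeInertia q k * (T.pose q k).Xinv) :
    (T.passK q s k).val = (Function.update s.1 (T.parent k)
        (s.1 (T.parent k) + (T.X q k)ᵀ * s.1 (some k) * T.X q k),
      fillOn (fun a b c => ∃ j', T.anc j' k ∧ ∃ i', T.anc i' j' ∧ IsPermOf i' j' k a b c)
        (T.Γ q) s.2) := by
  have hB : bodyB ((T.joint k).axis (q k)) (s.1 (some k)) =
      (T.pose q k).Xinvᵀ * bodyB (T.Φ q k) (T.compositeInertia q k) * (T.pose q k).Xinv := by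
    rw [hs, Pose.bodyB_congr]; rfl
  have hD : crossBar (s.1 (some k) *ᵥ (T.joint k).axis (q k)) -
      bodyB ((T.joint k).axis (q k)) (s.1 (some k)) =
      (T.pose q k).Xinvᵀ * (crossBar (T.compositeInertia q k *ᵥ T.Φ q k) -
        bodyB (T.Φ q k) (T.compositeInertia q k)) * (T.pose q k).Xinv := by
    rw [hB, mul_sub, sub_mul, Pose.transpose_Xinv_mul_crossBar, hs, congr_mulVec_axis]
  rw [(T.passK_eq q s k).1, hD, hB, T.val_loopJ q hT (T.anc_refl k)]

/-! ### Correctness of the algorithm -/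

-- `l` holds the bodies already processed, closed under larger numbers. A slot then contains the
-- body's own inertia plus the composites of its processed children; when `k` is next, all its
-- children are in `l` and the slot is the full composite inertia.
open Classical in
theorem foldr_passK_invariant (IC₀ : Option (Fin N) → SMat)
    (hIC : ∀ j, IC₀ (some j) = (T.inertia j).toMat) (l : List (Fin N))
    (hl : l.Pairwise (· < ·)) (hup : ∀ k ∈ l, ∀ m, k < m → m ∈ l) :
    let s := l.foldr (fun k s => (T.passK q s k).val) (IC₀, fun _ _ _ => 0)
    (∀ j, s.1 (some j) = (T.inertia j).toMat +
      ∑ c with c ∈ l ∧ T.parent c = some j,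
        (T.pose q j).Xinvᵀ * T.compositeInertia q c * (T.pose q j).Xinv) ∧
    s.2 = fillOn (fun a b c => ∃ k ∈ l, ∃ j, T.anc j k ∧ ∃ i, T.anc i j ∧ IsPermOf i j k a b c)
      (T.Γ q) fun _ _ _ => 0 := by
  induction l with
  | nil =>
    intro s
    refine ⟨fun j => by simp [s, hIC], ?_⟩
    funext a b c
    simp [s, fillOn]
  | cons k l ih =>
    intro s
    rw [List.pairwise_cons] at hl
    have hk : k ∉ l := fun h => lt_irrefl k (hl.1 k h)
    obtain ⟨ih1, ih2⟩ := ih hl.2 fun k' hk' m hm =>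
      (List.mem_cons.1 (hup k' (List.mem_cons_of_mem k hk') m hm)).resolve_left
        ((hl.1 k' hk').trans hm).ne'
    have hs : s = (T.passK q (l.foldr (fun k s => (T.passK q s k).val) (IC₀, fun _ _ _ => 0)) k).val :=
      rfl
    generalize l.foldr (fun k s => (T.passK q s k).val) (IC₀, fun _ _ _ => 0) = s₀ at ih1 ih2 hs
    have hchildren : (Finset.univ.filter fun c => c ∈ l ∧ T.parent c = some k) =
        Finset.univ.filter fun c => T.parent c = some k := by
      refine Finset.filter_congr fun c _ => and_iff_right_of_imp fun hc => ?_
      have hlt := T.parent_lt c k hc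
      exact (List.mem_cons.1 (hup k List.mem_cons_self c hlt)).resolve_left hlt.ne'
    have hcomp : s₀.1 (some k) =
        (T.pose q k).Xinvᵀ * T.compositeInertia q k * (T.pose q k).Xinv := by
      rw [ih1, hchildren, compositeInertia_eq_add_children, mul_add, add_mul,
        groundInertia_congr, Finset.mul_sum, Finset.sum_mul]
    rw [T.val_passK q hT s₀ hcomp] at hs
    rw [hs]
    refine ⟨fun j => ?_, ?_⟩
    · dsimp only
      by_cases hp : T.parent k = some j
      · rw [hp, Function.update_self, ih1, hcomp, congr_parent hp]
        have : (Finset.univ.filter fun c => c ∈ k :: l ∧ T.parent c = some j) =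
            insert k (Finset.univ.filter fun c => c ∈ l ∧ T.parent c = some j) := by
          ext c
          simp only [List.mem_cons, Finset.mem_filter, Finset.mem_univ, true_and,
            Finset.mem_insert]
          constructor
          · tauto
          · rintro (rfl | h)
            · exact ⟨Or.inl rfl, hp⟩
            · tauto
        rw [this, Finset.sum_insert (by simp [hk])]
        abel
      · rw [Function.update_of_ne (Ne.symm hp), ih1]
        refine congrArg _ (Finset.sum_congr (Finset.filter_congr fun c _ => ?_) fun _ _ => rfl)
        rw [List.mem_cons]
        constructor
        · tauto
        · rintro ⟨rfl | h, h'⟩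
          · exact absurd h' hp
          · exact ⟨h, h'⟩
    · dsimp only
      rw [ih2, fillOn_fillOn]
      exact fillOn_congr (fun a b c => by simp) _ _

omit hT in
theorem foldl_update_some (A : Fin N → SMat) (IC : Option (Fin N) → SMat) (l : List (Fin N))
    (j : Fin N) (hj : j ∈ l ∨ IC (some j) = A j) :
    l.foldl (fun IC i => Function.update IC (some i) (A i)) IC (some j) = A j := by
  induction l generalizing IC with
  | nil => simpa using hj
  | cons i l ih =>
    rw [List.foldl_cons]
    refine ih _ ?_
    by_cases hij : j = i
    · subst hij; simp
    · rw [Function.update_of_ne (by simpa using hij)]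
      simpa [hij] using hj

-- Pairwise comparable bodies form a chain. The two cyclic cases are consistent only when indices
-- coincide, and any two of the relations then suffice.
omit hT in
variable {T} in
theorem exists_chain_of_mutuallyRelated {a b c : Fin N} (h : T.mutuallyRelated a b c) :
    ∃ k j, T.anc j k ∧ ∃ i, T.anc i j ∧ IsPermOf i j k a b c := by
  obtain ⟨hab | hba, hbc | hcb, hac | hca⟩ := h
  · exact ⟨c, b, hbc, a, hab, by simp [IsPermOf]⟩
  · exact ⟨c, b, hbc, a, hab, by simp [IsPermOf]⟩
  · exact ⟨b, c, hcb, a, hac, by simp [IsPermOf]⟩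
  · exact ⟨b, a, hab, c, hca, by simp [IsPermOf]⟩
  · exact ⟨c, a, hac, b, hba, by simp [IsPermOf]⟩
  · exact ⟨a, c, hca, b, hbc, by simp [IsPermOf]⟩
  · exact ⟨a, b, hba, c, hcb, by simp [IsPermOf]⟩
  · exact ⟨a, b, hba, c, hcb, by simp [IsPermOf]⟩

theorem val_christoffelAlgorithm : (T.christoffelAlgorithm q).val = T.Γ q := by
  have hsorted : (List.finRange N).Pairwise (· < ·) := List.pairwise_lt_finRange N
  rw [christoffelAlgorithm]
  simp only [Timed.val_bind, Timed.val_pure, Timed.val_foldlM, Timed.assignMat, List.foldl_reverse]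
  rw [(T.foldr_passK_invariant q hT _
    (fun j => foldl_update_some (fun i => (T.inertia i).toMat) _ _ j (Or.inl (List.mem_finRange j)))
    _ hsorted fun _ _ m _ => List.mem_finRange m).2]
  funext a b c
  rw [fillOn]
  split_ifs with h
  · rfl
  -- An entry never written belongs to a triple that is not mutually related, so the initial zero is
  -- correct.
  · refine (T.Γ_of_not_mutuallyRelated hT q fun hr => h ?_).symm
    obtain ⟨k, hk⟩ := exists_chain_of_mutuallyRelated hr
    exact ⟨k, List.mem_finRange k, hk⟩

end Loops

end RigidTree

end Spatial

end

theorem mainTheorem4 :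
    ∃ C : ℕ, ∀ (N : ℕ) (T : Spatial.RigidTree N),
      (∀ (i : Fin N) (x : ℝ), HasDerivAt (T.joint i).axis 0 x) →
      -- the mass matrix is differentiable, so its partial derivatives are genuine
      (∀ i j : Fin N, Differentiable ℝ fun q : Fin N → ℝ => T.massMatrix q i j) ∧
      ∀ q : Fin N → ℝ,
        -- closed form
        (∀ i j k : Fin N, T.mutuallyRelated i j k → T.anc j k →
          T.Γ q i j k = T.Γ q i k j ∧
          T.Γ q i j k = T.Φ q i ⬝ᵥ
            (Spatial.bodyB (T.Φ q k) (T.compositeInertia q (T.leafmost (T.leafmost i j) k)) *ᵥ T.Φ q j)) ∧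
        (∀ i j k : Fin N, ¬ T.mutuallyRelated i j k → T.Γ q i j k = 0 ∧ T.Γ q i k j = 0) ∧
        -- formulas along a chain
        (∀ i j k : Fin N, T.anc i j → T.anc j k →
          (T.Γ q i j k = T.Γ q i k j ∧
            T.Γ q i j k =
              T.Φ q i ⬝ᵥ (Spatial.bodyB (T.Φ q k) (T.compositeInertia q k) *ᵥ T.Φ q j)) ∧
          (T.Γ q j i k = T.Γ q j k i ∧
            T.Γ q j i k =
              T.Φ q j ⬝ᵥ (Spatial.bodyB (T.Φ q k) (T.compositeInertia q k) *ᵥ T.Φ q i)) ∧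
          (T.Γ q k i j = T.Γ q k j i ∧
            T.Γ q k i j =
              T.Φ q k ⬝ᵥ (Spatial.bodyB (T.Φ q j) (T.compositeInertia q k) *ᵥ T.Φ q i)) ∧
          T.Γ q k i j = (1 / 2 : ℝ) * (T.Φ q i ⬝ᵥ
            ((T.compositeInertia q k * Spatial.crossM (T.Φ q k) - Spatial.crossF (T.Φ q k) * T.compositeInertia q k
              + Spatial.crossBar (T.compositeInertia q k *ᵥ T.Φ q k)) *ᵥ T.Φ q j)) ∧
          T.Γ q k i j = T.Φ q i ⬝ᵥ
            ((Spatial.crossBar (T.compositeInertia q k *ᵥ T.Φ q k)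
              - Spatial.bodyB (T.Φ q k) (T.compositeInertia q k)) *ᵥ T.Φ q j)) ∧
        -- the algorithm returns all symbols, with cost of order `N d²`
        (T.christoffelAlgorithm q).val = T.Γ q ∧
        (T.christoffelAlgorithm q).cost ≤ C * (N * T.depth ^ 2) := by
  
  refine ⟨4284, fun N T hT => ⟨T.differentiable_massMatrix hT, fun q => ⟨fun i j k h hjk =>
    ⟨T.Γ_comm q i j k, T.Γ_eq_bodyB_leafmost hT q h hjk⟩, fun i j k h => ⟨?_, ?_⟩,
    fun i j k hij hjk => ⟨⟨T.Γ_comm q i j k, T.Γ_root hT q hij hjk⟩,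
      ⟨T.Γ_comm q j i k, T.Γ_middle hT q hij hjk⟩,
      ⟨T.Γ_comm q k i j, T.Γ_leaf_eq_bodyB hT q hij hjk⟩,
      T.Γ_leaf hT q hij hjk, T.Γ_leaf_eq_crossBar_sub_bodyB hT q hij hjk⟩,
    T.val_christoffelAlgorithm q hT, T.cost_christoffelAlgorithm_le q⟩⟩⟩
  · exact T.Γ_of_not_mutuallyRelated hT q h
  · rw [← T.Γ_comm q i j k]
    exact T.Γ_of_not_mutuallyRelated hT q h
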